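/- Let $\mathcal H$ and $\mathcal X$ be (real or complex) Hilbert spaces. A family $U(t,s)\in\mathcal L(\mathcal H)$, $s\le t$ in an interval $I$, is an evolution operator on $I$ if $U(t,t)=\mathbf I$, $U(t,r)U(r,s)=U(t,s)$ for $s\le r\le t$, and $U(\cdot,s)$ and $U(t,\cdot)$ are strongly continuous. Let $Y(t,s)$ be an evolution operator on $[0,\infty)$ (generated by $A_c(t)$). For an operator function $D(t)$, let $Y_D$ denote the evolution operator satisfying $$Y_D(t,s)w=Y(t,s)w+\int_s^tY(t,r)D(r)Y_D(r,s)w\,dr,\qquad w\in\mathcal H .$$ An evolution operator $U$ on $[0,\infty)$ is exponentially stable if $\|U(t,s)\|\le Me^{-\alpha(t-s)}$ for all $0\le s\le t$, with some $M\ge0$, $\alpha>0$. Let $B_c(t)\in\mathcal L(\mathcal X,\mathcal H)$, $W_c(t)\in\mathcal L(\mathcal H)$ and $R_c(t)\in\mathcal L(\mathcal X)$ be norm-continuous and uniformly bounded on $[0,\infty)$, let $W_c(t)$ be self-adjoint and nonnegative, let $R_c(t)$ be self-adjoint and coercive uniformly in $t$, and let $P_0\in\mathcal L(\mathcal H)$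 be self-adjoint and nonnegative. Assume that * $(A_c,B_c)$ is uniformly stabilizable: there is a norm-continuous, uniformly bounded $K:[0,\infty)\to\mathcal L(\mathcal H,\mathcal X)$ such that $Y_{B_cK}$ exists and is exponentially stable; * $(A_c,W_c^{1/2})$ is uniformly detectable: there is a norm-continuous, uniformly bounded $L:[0,\infty)\to\mathcal L(\mathcal H)$ such that $Y_{LW_c^{1/2}}$ exists and is exponentially stable. For $t_f>0$ let $P_{t_f}:[0,t_f]\to\mathcal L(\mathcal H)$, strongly measurable and essentially bounded, be the solution, together with the evolution operator $Y_{-B_cK_{t_f}}$ on $[0,t_f]$, where $K_{t_f}(t)=R_c^{-1}(t)B_c^*(t)P_{t_f}(t)$ is the optimal feedback, of the integral Riccati equation $$P_{t_f}(s)z=Y_{-B_cK_{t_f}}^*(t_f,s)P_0Y_{-B_cK_{t_f}}(t_f,s)z+\int_s^{t_f}Y_{-B_cK_{t_f}}^*(r,s)\bigl(W_c(r)+P_{t_f}(r)B_c(r)R_c^{-1}(r)B_c^*(r)P_{t_f}(r)\bigr)Y_{-B_cK_{t_f}}(r,s)z\,dr$$ for all $s\in[0,t_f]$ and $z\in\mathcal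 H$. Then there are constants $\delta_P,\delta_Y$, independent of $t_f$, such that for every $t_f>0$ $$\|P_{t_f}(0)\|\le\delta_P\qquad\text{and}\qquad \|Y_{-B_cK_{t_f}}(t,s)\|\le\delta_Y\quad\text{for all }0\le s\le t\le t_f .$$ -/

import Mathlib

open MeasureTheory Set

section EvolutionOperators

variable {𝕜 : Type*} [RCLike 𝕜]
  {H : Type*} [NormedAddCommGroup H] [InnerProductSpace 𝕜 H]

/-- `U(t,s)`, for `s ≤ t` in the time interval `I`, is an evolution operator: `U(t,t)` is the
identity, `U(t,r) U(r,s) = U(t,s)`, and `U` is strongly continuous in each of its two arguments.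
The values `U t s` with `t < s` or with `t` or `s` outside `I` play no role. -/
structure IsEvolutionOperator (I : Set ℝ) (U : ℝ → ℝ → H →L[𝕜] H) : Prop where
  refl : ∀ t ∈ I, U t t = ContinuousLinearMap.id 𝕜 H
  comp : ∀ s ∈ I, ∀ r ∈ I, ∀ t ∈ I, s ≤ r → r ≤ t → U t r ∘L U r s = U t s
  continuousOn_left : ∀ s ∈ I, ∀ x : H, ContinuousOn (fun t => U t s x) (I ∩ Ici s)
  continuousOn_right : ∀ t ∈ I, ∀ x : H, ContinuousOn (fun s => U t s x) (I ∩ Iic t)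

/-- `V` is the evolution operator obtained from the evolution operator `Y` by the perturbation
`D(t)` of its generator: for `s ≤ t` in `I`,
`V(t,s) w = Y(t,s) w + ∫ₛᵗ Y(t,r) D(r) V(r,s) w dr`, as a Bochner integral. -/
structure IsPerturbedEvolutionOperator [NormedSpace ℝ H] (I : Set ℝ) (Y : ℝ → ℝ → H →L[𝕜] H)
    (D : ℝ → H →L[𝕜] H) (V : ℝ → ℝ → H →L[𝕜] H) : Prop where
  evolution : IsEvolutionOperator I V
  integrable : ∀ s ∈ I, ∀ t ∈ I, s ≤ t → ∀ w : H,
    IntervalIntegrable (fun r => Y t r (D r (V r s w))) volume s t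
  eq : ∀ s ∈ I, ∀ t ∈ I, s ≤ t → ∀ w : H,
    V t s w = Y t s w + ∫ r in s..t, Y t r (D r (V r s w))

/-- Exponential stability of an evolution operator on `0 ≤ s ≤ t < ∞`. -/
def IsExponentiallyStable (Y : ℝ → ℝ → H →L[𝕜] H) : Prop :=
  ∃ M ≥ (0 : ℝ), ∃ α > (0 : ℝ), ∀ s t : ℝ, 0 ≤ s → s ≤ t → ‖Y t s‖ ≤ M * Real.exp (-α * (t - s))

end EvolutionOperators

section BoundedContinuous

variable {𝕜 : Type*} [RCLike 𝕜]
  {E : Type*} [NormedAddCommGroup E] [InnerProductSpace 𝕜 E]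
  {F : Type*} [NormedAddCommGroup F] [InnerProductSpace 𝕜 F]

/-- An operator-valued function on `[0,∞)` that is continuous in operator norm and uniformly
bounded. -/
def IsBoundedContinuous (G : ℝ → E →L[𝕜] F) : Prop :=
  ContinuousOn G (Ici 0) ∧ ∃ C : ℝ, ∀ t : ℝ, 0 ≤ t → ‖G t‖ ≤ C

/-- An operator-valued function on `[0,T]` that is strongly measurable (that is, `t ↦ G(t) x` is
strongly measurable for each `x`) and essentially bounded. -/
def IsStronglyMeasurableEssBounded (T : ℝ) (G : ℝ → E →L[𝕜] F) : Prop :=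
  (∀ x : E, AEStronglyMeasurable (fun t => G t x) (volume.restrict (Icc 0 T))) ∧
    ∃ C : ℝ, ∀ᵐ t ∂(volume.restrict (Icc 0 T)), ‖G t‖ ≤ C

end BoundedContinuous

section Control

variable {𝕜 : Type*} [RCLike 𝕜]
  {H : Type*} [NormedAddCommGroup H] [InnerProductSpace 𝕜 H] [NormedSpace ℝ H]
  {X : Type*} [NormedAddCommGroup X] [InnerProductSpace 𝕜 X]

/-- Uniform detectability of `(A_c, C)`, where `A_c(t)` generates the evolution operator `Y`:
some bounded continuous output injection `L` makes the evolution operator generated by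
`A_c(t) + L(t) C(t)` exponentially stable. -/
def IsUniformlyDetectable (Y : ℝ → ℝ → H →L[𝕜] H) (C : ℝ → H →L[𝕜] X) : Prop :=
  ∃ L : ℝ → X →L[𝕜] H, IsBoundedContinuous L ∧
    ∃ YL : ℝ → ℝ → H →L[𝕜] H,
      IsPerturbedEvolutionOperator (Ici 0) Y (fun t => L t ∘L C t) YL ∧ IsExponentiallyStable YL

/-- Uniform stabilizability of `(A_c, B)`, where `A_c(t)` generates the evolution operator `Y`:
some bounded continuous feedback `K` makes the evolution operator generated by
`A_c(t) + B(t) K(t)` exponentially stable. -/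
def IsUniformlyStabilizable (Y : ℝ → ℝ → H →L[𝕜] H) (B : ℝ → X →L[𝕜] H) : Prop :=
  ∃ K : ℝ → H →L[𝕜] X, IsBoundedContinuous K ∧
    ∃ YK : ℝ → ℝ → H →L[𝕜] H,
      IsPerturbedEvolutionOperator (Ici 0) Y (fun t => B t ∘L K t) YK ∧ IsExponentiallyStable YK

/-- `S(t)` is the square root `W(t)^{1/2}`, i.e. the (unique) nonnegative self-adjoint operator
with square `W(t)`, for each `t ≥ 0`. -/
def IsPositiveSqrt (S W : ℝ → H →L[𝕜] H) : Prop :=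
  ∀ t : ℝ, 0 ≤ t → (S t).IsPositive ∧ S t ∘L S t = W t

variable [CompleteSpace H] [CompleteSpace X]

/-- The feedback operator `K(t) = R(t)⁻¹ B(t)* P(t)`. -/
noncomputable def riccatiFeedback (B : ℝ → X →L[𝕜] H) (R : ℝ → X →L[𝕜] X) (P : ℝ → H →L[𝕜] H)
    (t : ℝ) : H →L[𝕜] X :=
  (R t).inverse ∘L (B t).adjoint ∘L P t

/-- `P` solves on `[0,T]` the integral Riccati equation of the linear quadratic control problem
with dynamics `(Y, B)`, terminal weight `P₀`, state weight `W` and control weight `R`, and `V` is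
the closed-loop evolution operator: with `K(t) = R(t)⁻¹ B(t)* P(t)`, `V` is the perturbation of
`Y` by `-B(t) K(t)`, and for all `s ∈ [0,T]`, `x ∈ H`,
`P(s) x = V(T,s)* P₀ V(T,s) x + ∫ₛᵀ V(r,s)* (W(r) + P(r) B(r) R(r)⁻¹ B(r)* P(r)) V(r,s) x dr`,
as a Bochner integral. -/
structure IsRiccatiSolution (Y : ℝ → ℝ → H →L[𝕜] H) (B : ℝ → X →L[𝕜] H) (P₀ : H →L[𝕜] H)
    (W : ℝ → H →L[𝕜] H) (R : ℝ → X →L[𝕜] X) (T : ℝ)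
    (P : ℝ → H →L[𝕜] H) (V : ℝ → ℝ → H →L[𝕜] H) : Prop where
  bounded : IsStronglyMeasurableEssBounded T P
  closedLoop : IsPerturbedEvolutionOperator (Icc 0 T) Y
    (fun t => -(B t ∘L riccatiFeedback B R P t)) V
  integrable : ∀ s ∈ Icc 0 T, ∀ x : H, IntervalIntegrable
    (fun r => (V r s).adjoint ((W r + P r ∘L B r ∘L riccatiFeedback B R P r) (V r s x)))
    volume s T
  eq : ∀ s ∈ Icc 0 T, ∀ x : H,
    P s x = (V T s).adjoint (P₀ (V T s x)) +
      ∫ r in s..T, (V r s).adjoint ((W r + P r ∘L B r ∘L riccatiFeedback B R P r) (V r s x))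

end Control

/-! ### Exponential integrals and Gronwall inequalities without measurability -/

section Gronwall

/-! The Riccati solution is a value function: `⟨x, P(s)x⟩` equals the quadratic cost of the closed
loop on `[s,T]` and is at most the cost of any bounded feedback (`IsRiccatiSolution.cost`).
Inserting the stabilizing feedback, whose trajectories decay exponentially, bounds this cost by
`δ‖x‖²` with `δ` independent of `T`. Since `P(s)` is symmetric and its form nonnegative, the bound
on the form is a bound on the norm.

The same cost controls the closed loop. Coercivity of `R` bounds the integral over `[s,t]` of
`‖W^{1/2}Vx‖² + δ₀‖KVx‖²` by `δ‖x‖²`. By detectability, `V` is a perturbation of the exponentially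
stable `YL` by `-BK - LW^{1/2}` (`IsPerturbedEvolutionOperator.eq_add_integral`). The integral term
is thus a convolution of a decaying exponential with square integrable functions, bounded uniformly
in `T` (`integral_exp_mul_le`).

No generator is differentiated: everything rests on integral equations, Fubini on a triangle and
Gronwall. Minimality comes from testing the Lyapunov equation along a competing mild solution
(`IsLyapunovSolution.inner_mild`) and applying the arithmetic-geometric mean inequality to the cross
terms. Symmetry of `P` is derived, not assumed. Norm continuity of `W^{1/2}` comes from the Hölder
estimate `sq_norm_sub_le_of_isPositive`. -/

lemma integral_exp_mul_add {c : ℝ} (hc : c ≠ 0) (d a b : ℝ) :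
    ∫ r in a..b, Real.exp (c * r + d) = (Real.exp (c * b + d) - Real.exp (c * a + d)) / c := by
  have h : ∀ x ∈ uIcc a b,
      HasDerivAt (fun r => Real.exp (c * r + d) / c) (Real.exp (c * x + d)) x := by
    intro x _
    have h1 : HasDerivAt (fun r : ℝ => c * r + d) c x := by
      simpa using ((hasDerivAt_id x).const_mul c).add_const d
    have h2 := (h1.exp).div_const c
    rwa [mul_div_cancel_right₀ _ hc] at h2
  rw [intervalIntegral.integral_eq_sub_of_hasDerivAt h
    (Continuous.intervalIntegrable (by fun_prop) _ _)]
  ring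

lemma integral_exp_neg_mul_sub_le {β : ℝ} (hβ : 0 < β) (a b : ℝ) :
    ∫ r in a..b, Real.exp (-β * (b - r)) ≤ 1 / β := by
  have h := integral_exp_mul_add hβ.ne' (-β * b) a b
  have e : ∀ r, β * r + -β * b = -β * (b - r) := fun r => by ring
  simp only [e] at h
  rw [h]
  gcongr
  have := Real.exp_pos (-β * (b - a))
  simp only [sub_self, mul_zero, Real.exp_zero]
  linarith

lemma integral_exp_neg_mul_sub_le' {β : ℝ} (hβ : 0 < β) (a b : ℝ) :
    ∫ r in a..b, Real.exp (-β * (r - a)) ≤ 1 / β := by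
  have h := integral_exp_mul_add (neg_ne_zero.mpr hβ.ne') (β * a) a b
  have e : ∀ r, -β * r + β * a = -β * (r - a) := fun r => by ring
  simp only [e] at h
  rw [h, div_neg, ← neg_div]
  gcongr
  have := Real.exp_pos (-β * (b - a))
  simp only [sub_self, mul_zero, Real.exp_zero]
  linarith

/-- A Gronwall inequality for functions that are only assumed bounded: the integral inequality is
required for continuous majorants. -/
lemma gronwall_forward {a b A C M : ℝ} {f : ℝ → ℝ} (hA : 0 ≤ A) (hC : 0 ≤ C)
    (hM : ∀ t ∈ Icc a b, f t ≤ M)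
    (h : ∀ g : ℝ → ℝ, Continuous g → (∀ r, 0 ≤ g r) → (∀ r ∈ Icc a b, f r ≤ g r) →
      ∀ t ∈ Icc a b, f t ≤ A + C * ∫ r in a..t, g r) :
    ∀ t ∈ Icc a b, f t ≤ 2 * A * Real.exp ((2 * C + 1) * (t - a)) := by
  -- The rate `l` satisfies `C / l ≤ 1/2`, so in the norm weighted by `exp (l (t - a))` the integral
  -- inequality turns a majorant `N` into `A + N/2`. Iteration drives the constant to the fixed
  -- point `2A`.
  set l := 2 * C + 1 with hl
  have hlpos : 0 < l := by positivity
  have step : ∀ N : ℝ, 0 ≤ N → (∀ t ∈ Icc a b, f t ≤ N * Real.exp (l * (t - a))) →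
      ∀ t ∈ Icc a b, f t ≤ (A + N / 2) * Real.exp (l * (t - a)) := by
    intro N hN hf t ht
    have h1 := h (fun t => N * Real.exp (l * (t - a))) (by fun_prop)
      (fun r => by positivity) hf t ht
    have h2 : ∫ r in a..t, N * Real.exp (l * (r - a)) = N * ((Real.exp (l * (t - a)) - 1) / l) := by
      have h3 := integral_exp_mul_add hlpos.ne' (-l * a) a t
      have e : ∀ r, l * r + -l * a = l * (r - a) := fun r => by ring
      simp only [e, sub_self, mul_zero, Real.exp_zero] at h3
      rw [intervalIntegral.integral_const_mul, h3]
    rw [h2] at h1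
    have hE : 1 ≤ Real.exp (l * (t - a)) :=
      Real.one_le_exp (mul_nonneg hlpos.le (sub_nonneg.mpr ht.1))
    have h4 : C * (N * ((Real.exp (l * (t - a)) - 1) / l)) ≤ N / 2 * Real.exp (l * (t - a)) := by
      have : C * (N * ((Real.exp (l * (t - a)) - 1) / l))
          = (C / l) * (N * (Real.exp (l * (t - a)) - 1)) := by ring
      rw [this]
      have h5 : C / l ≤ 1 / 2 := by rw [div_le_iff₀ hlpos]; linarith
      have h6 : 0 ≤ N * (Real.exp (l * (t - a)) - 1) := mul_nonneg hN (by linarith)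
      nlinarith
    nlinarith
  have iter : ∀ n : ℕ, ∀ t ∈ Icc a b,
      f t ≤ (2 * A + |M| * (1 / 2) ^ n) * Real.exp (l * (t - a)) := by
    intro n
    induction n with
    | zero =>
      intro t ht
      have hE : 1 ≤ Real.exp (l * (t - a)) :=
        Real.one_le_exp (mul_nonneg hlpos.le (sub_nonneg.mpr ht.1))
      have := hM t ht
      have := le_abs_self M
      have := abs_nonneg M
      simp only [pow_zero, mul_one]
      nlinarith
    | succ n ih =>
      intro t ht
      have := step _ (by positivity) ih t ht
      convert this using 2
      ring
  intro t ht
  have hlim : Filter.Tendsto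
      (fun n : ℕ => (2 * A + |M| * (1 / 2 : ℝ) ^ n) * Real.exp (l * (t - a))) Filter.atTop
      (nhds ((2 * A + |M| * 0) * Real.exp (l * (t - a)))) := by
    have := tendsto_pow_atTop_nhds_zero_of_lt_one (r := (1 / 2 : ℝ)) (by norm_num) (by norm_num)
    exact ((this.const_mul _).const_add _).mul_const _
  have := ge_of_tendsto' hlim (fun n => iter n t ht)
  simpa using this

lemma gronwall_backward {a b A C M : ℝ} {f : ℝ → ℝ} (hA : 0 ≤ A) (hC : 0 ≤ C)
    (hM : ∀ t ∈ Icc a b, f t ≤ M)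
    (h : ∀ g : ℝ → ℝ, Continuous g → (∀ r, 0 ≤ g r) → (∀ r ∈ Icc a b, f r ≤ g r) →
      ∀ t ∈ Icc a b, f t ≤ A + C * ∫ r in t..b, g r) :
    ∀ t ∈ Icc a b, f t ≤ 2 * A * Real.exp ((2 * C + 1) * (b - t)) := by
  have refl_mem : ∀ {t}, t ∈ Icc a b → a + b - t ∈ Icc a b := by
    rintro t ⟨h1, h2⟩
    constructor <;> linarith
  have key := gronwall_forward (a := a) (b := b) (f := fun t => f (a + b - t)) (M := M) hA hC
    (fun t ht => hM _ (refl_mem ht)) (by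
      intro g hg hg0 hfg t ht
      have h1 := h (fun r => g (a + b - r)) (by fun_prop) (fun r => hg0 _)
        (fun r hr => by simpa using hfg _ (refl_mem hr)) _ (refl_mem ht)
      rw [intervalIntegral.integral_comp_sub_left] at h1
      simpa using h1)
  intro t ht
  have := key _ (refl_mem ht)
  have e : a + b - t - a = b - t := by ring
  simpa [e] using this

end Gronwall

/-! ### Symmetric and nonnegative operators, square roots, coercive inverses -/

section SelfAdjoint

variable {𝕜 : Type*} [RCLike 𝕜]
  {H : Type*} [NormedAddCommGroup H] [InnerProductSpace 𝕜 H]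

local notation "⟪" x ", " y "⟫" => inner 𝕜 x y

/-- A symmetric operator is bounded in norm by the bound of its quadratic form. -/
lemma opNorm_le_of_abs_re_inner_le {D : H →L[𝕜] H} (hD : ∀ x y, ⟪D x, y⟫ = ⟪x, D y⟫) {δ : ℝ}
    (hδ : 0 ≤ δ) (h : ∀ x, |RCLike.re ⟪x, D x⟫| ≤ δ * ‖x‖ ^ 2) : ‖D‖ ≤ δ := by
  refine D.opNorm_le_bound hδ fun x => ?_
  by_cases hDx : ‖D x‖ = 0
  · rw [hDx]; positivity
  have hpos : 0 < ‖D x‖ := lt_of_le_of_ne (norm_nonneg _) (Ne.symm hDx)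
  -- Polarization with `y` the multiple of `D x` of norm `‖x‖`: then `re ⟨y, D x⟩ = ‖x‖ ‖D x‖`, and
  -- the parallelogram law bounds the difference of the two forms by `4 δ ‖x‖²`.
  set c : ℝ := ‖x‖ / ‖D x‖ with hc
  set y : H := (c : 𝕜) • D x with hy
  have hny : ‖y‖ = ‖x‖ := by
    rw [hy, norm_smul, RCLike.norm_ofReal, abs_of_nonneg (by positivity), hc]
    field_simp
  have h1 : RCLike.re ⟪x + y, D (x + y)⟫ - RCLike.re ⟪x - y, D (x - y)⟫
      = 4 * RCLike.re ⟪y, D x⟫ := by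
    have e : RCLike.re ⟪x, D y⟫ = RCLike.re ⟪y, D x⟫ := by rw [← hD, inner_re_symm]
    simp only [map_add, map_sub, inner_add_left, inner_add_right, inner_sub_left, inner_sub_right]
    rw [e]; ring
  have h2 : RCLike.re ⟪y, D x⟫ = ‖x‖ * ‖D x‖ := by
    rw [hy, inner_smul_left, RCLike.conj_ofReal, RCLike.re_ofReal_mul, inner_self_eq_norm_sq, hc]
    field_simp
  have h3 := parallelogram_law_with_norm 𝕜 x y
  have h4 := (le_abs_self _).trans (h (x + y))
  have h5 := (neg_le_abs _).trans (h (x - y))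
  rw [hny] at h3
  have h6 : 4 * (‖x‖ * ‖D x‖) ≤ 4 * (δ * ‖x‖ ^ 2) := by
    rw [← h2, ← h1]
    nlinarith
  by_cases hx : ‖x‖ = 0
  · have : x = 0 := norm_eq_zero.mp hx
    simp [this]
  have hxpos : 0 < ‖x‖ := lt_of_le_of_ne (norm_nonneg _) (Ne.symm hx)
  nlinarith

/-- The square root of nonnegative operators is Hölder continuous of exponent one half. -/
lemma sq_norm_sub_le_of_isPositive {S T : H →L[𝕜] H} (hS : S.IsPositive) (hT : T.IsPositive) :
    ‖S - T‖ ^ 2 ≤ ‖S ∘L S - T ∘L T‖ := by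
  set D := S - T with hD
  set w := ‖S ∘L S - T ∘L T‖ with hw
  have symS : ∀ x y, ⟪S x, y⟫ = ⟪x, S y⟫ := hS.1
  have symT : ∀ x y, ⟪T x, y⟫ = ⟪x, T y⟫ := hT.1
  have symD : ∀ x y, ⟪D x, y⟫ = ⟪x, D y⟫ := by
    intro x y
    simp [hD, inner_sub_left, inner_sub_right, symS, symT]
  have posS : ∀ x, 0 ≤ RCLike.re ⟪x, S x⟫ := hS.re_inner_nonneg_right
  have posT : ∀ x, 0 ≤ RCLike.re ⟪x, T x⟫ := hT.re_inner_nonneg_right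
  set c := ‖S‖ + ‖T‖ with hc
  have hc0 : 0 ≤ c := by positivity
  -- The residual `e = D x - l x` measures how far `x` is from being an eigenvector. If `e`
  -- vanished, `S² - T² = S D + D T` would have form `l (⟨x, S x⟩ + ⟨x, T x⟩)`, whose modulus is at
  -- least `l²` because `l = ⟨x, S x⟩ - ⟨x, T x⟩` with both terms nonnegative. The general case
  -- costs an error `c ‖e‖`, with `‖e‖² ≤ ‖D‖² - l²`.
  have key : ∀ x : H, ‖x‖ = 1 → (RCLike.re ⟪x, D x⟫) ^ 2 ≤
      w + c * Real.sqrt (‖D‖ ^ 2 - (RCLike.re ⟪x, D x⟫) ^ 2) := by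
    intro x hx
    set l := RCLike.re ⟪x, D x⟫ with hl
    set e : H := D x - (l : 𝕜) • x with he
    have hDx : D x = (l : 𝕜) • x + e := by simp [he]
    have hnD : ‖D x‖ ≤ ‖D‖ := by simpa [hx] using D.le_opNorm x
    have hne : ‖e‖ ≤ Real.sqrt (‖D‖ ^ 2 - l ^ 2) := by
      apply Real.le_sqrt_of_sq_le
      have h1 := norm_sub_sq (𝕜 := 𝕜) (D x) ((l : 𝕜) • x)
      rw [inner_smul_right, RCLike.re_ofReal_mul, inner_re_symm, ← hl, norm_smul, hx,
        RCLike.norm_ofReal, mul_one, sq_abs] at h1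
      have := pow_le_pow_left₀ (norm_nonneg _) hnD 2
      rw [he, h1]; nlinarith
    have h2 : RCLike.re ⟪x, (S ∘L S - T ∘L T) x⟫
        = l * (RCLike.re ⟪x, S x⟫ + RCLike.re ⟪x, T x⟫) + RCLike.re ⟪S x, e⟫
          + RCLike.re ⟪e, T x⟫ := by
      have h3 : (S ∘L S - T ∘L T) x = S (D x) + D (T x) := by simp [hD]
      rw [h3, inner_add_right, ← symS x (D x), ← symD x (T x), hDx, inner_add_right, inner_add_left,
        inner_smul_right, inner_smul_left, RCLike.conj_ofReal, map_add, map_add, map_add,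
        RCLike.re_ofReal_mul, RCLike.re_ofReal_mul, symS]
      ring
    have h4 : |RCLike.re ⟪x, (S ∘L S - T ∘L T) x⟫| ≤ w := by
      refine (RCLike.abs_re_le_norm _).trans ((norm_inner_le_norm _ _).trans ?_)
      simpa [hx, hw] using (S ∘L S - T ∘L T).le_opNorm x
    have h5 : |RCLike.re ⟪S x, e⟫| ≤ ‖S‖ * ‖e‖ := by
      refine (RCLike.abs_re_le_norm _).trans ((norm_inner_le_norm _ _).trans ?_)
      have : ‖S x‖ ≤ ‖S‖ := by simpa [hx] using S.le_opNorm x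
      gcongr
    have h6 : |RCLike.re ⟪e, T x⟫| ≤ ‖T‖ * ‖e‖ := by
      refine (RCLike.abs_re_le_norm _).trans ((norm_inner_le_norm _ _).trans ?_)
      have : ‖T x‖ ≤ ‖T‖ := by simpa [hx] using T.le_opNorm x
      rw [mul_comm]
      gcongr
    have h7 : l = RCLike.re ⟪x, S x⟫ - RCLike.re ⟪x, T x⟫ := by
      simp [hl, hD, inner_sub_right]
    have h8 : |l| ≤ RCLike.re ⟪x, S x⟫ + RCLike.re ⟪x, T x⟫ := by
      have := posS x; have := posT x
      rw [abs_le]; constructor <;> linarith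
    have h9 : l ^ 2 ≤ |l * (RCLike.re ⟪x, S x⟫ + RCLike.re ⟪x, T x⟫)| := by
      rw [abs_mul, ← sq_abs, sq]
      exact mul_le_mul_of_nonneg_left (h8.trans (le_abs_self _)) (abs_nonneg _)
    have h10 : |l * (RCLike.re ⟪x, S x⟫ + RCLike.re ⟪x, T x⟫)| ≤ w + ‖S‖ * ‖e‖ + ‖T‖ * ‖e‖ := by
      have : l * (RCLike.re ⟪x, S x⟫ + RCLike.re ⟪x, T x⟫)
          = RCLike.re ⟪x, (S ∘L S - T ∘L T) x⟫ - RCLike.re ⟪S x, e⟫ - RCLike.re ⟪e, T x⟫ := by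
        rw [h2]; ring
      rw [this]
      exact (abs_sub _ _).trans (add_le_add ((abs_sub _ _).trans (add_le_add h4 h5)) h6)
    have h11 : c * ‖e‖ ≤ c * Real.sqrt (‖D‖ ^ 2 - l ^ 2) := by gcongr
    rw [hc] at h11 ⊢
    linarith
  by_contra hcon
  push Not at hcon
  have hd0 : 0 < ‖D‖ := by
    rcases (norm_nonneg D).eq_or_lt with h | h
    · rw [← h] at hcon
      have : 0 ≤ w := norm_nonneg _
      simp at hcon; linarith
    · exact h
  have hcont : ContinuousAt (fun m : ℝ => m ^ 2 - c * Real.sqrt (‖D‖ ^ 2 - m ^ 2)) ‖D‖ := by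
    fun_prop
  -- If `w < ‖D‖²`, some `m` just below `‖D‖` still violates the inequality of `key`, as does every
  -- larger value up to `‖D‖`. Hence `|l| ≤ m` for all unit vectors, contradicting `m < ‖D‖`.
  have hev : ∀ᶠ m in nhdsWithin ‖D‖ (Iio ‖D‖),
      0 < m ∧ w < m ^ 2 - c * Real.sqrt (‖D‖ ^ 2 - m ^ 2) := by
    refine nhdsWithin_le_nhds ((eventually_gt_nhds hd0).and ?_)
    apply hcont.eventually_const_lt
    simpa using hcon
  obtain ⟨m, ⟨hm0, hm1⟩, hm2⟩ := (hev.and self_mem_nhdsWithin).exists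
  have hle : ‖D‖ ≤ m := by
    refine opNorm_le_of_abs_re_inner_le symD hm0.le fun x => ?_
    by_cases hx : x = 0
    · simp [hx]
    have hx' : 0 < ‖x‖ := norm_pos_iff.mpr hx
    set x' : H := ((‖x‖⁻¹ : ℝ) : 𝕜) • x with hx'def
    have hnx' : ‖x'‖ = 1 := by
      rw [hx'def, norm_smul, RCLike.norm_ofReal, abs_of_pos (by positivity)]
      field_simp
    have hk := key x' hnx'
    have hxx : x = ((‖x‖ : ℝ) : 𝕜) • x' := by
      rw [hx'def, smul_smul, ← RCLike.ofReal_mul, mul_inv_cancel₀ hx'.ne', RCLike.ofReal_one,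
        one_smul]
    have hval : RCLike.re ⟪x, D x⟫ = ‖x‖ ^ 2 * RCLike.re ⟪x', D x'⟫ := by
      conv_lhs => rw [hxx]
      rw [map_smul, inner_smul_left, inner_smul_right, RCLike.conj_ofReal, RCLike.re_ofReal_mul,
        RCLike.re_ofReal_mul]
      ring
    set l := RCLike.re ⟪x', D x'⟫ with hl
    have hlm : |l| ≤ m := by
      by_contra hlm
      push Not at hlm
      have h1 : m ^ 2 ≤ l ^ 2 := by rw [← sq_abs l]; gcongr
      have h2 : Real.sqrt (‖D‖ ^ 2 - l ^ 2) ≤ Real.sqrt (‖D‖ ^ 2 - m ^ 2) :=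
        Real.sqrt_le_sqrt (by linarith)
      have h3 := mul_le_mul_of_nonneg_left h2 hc0
      linarith
    rw [hval, abs_mul, abs_of_nonneg (by positivity), mul_comm]
    gcongr
  exact absurd hm2 (not_lt.mpr hle)

/-- Detectability involves `W^{1/2}`, while continuity is assumed only for `W`. The Hölder estimate
transfers it, which makes `L W^{1/2}` an admissible perturbation. -/
lemma continuousOn_sqrt {s : Set ℝ} {S W : ℝ → H →L[𝕜] H}
    (h : ∀ t ∈ s, (S t).IsPositive ∧ S t ∘L S t = W t) (hW : ContinuousOn W s) :
    ContinuousOn S s := by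
  intro t ht
  have h1 : Filter.Tendsto (fun r => Real.sqrt ‖W r - W t‖) (nhdsWithin t s) (nhds 0) := by
    have h2 : ContinuousWithinAt (fun r => Real.sqrt ‖W r - W t‖) s t :=
      ((hW t ht).sub continuousWithinAt_const).norm.sqrt
    simpa [ContinuousWithinAt] using h2
  rw [ContinuousWithinAt, tendsto_iff_norm_sub_tendsto_zero]
  refine squeeze_zero' (Filter.Eventually.of_forall fun _ => norm_nonneg _) ?_ h1
  filter_upwards [self_mem_nhdsWithin] with r hr
  apply Real.le_sqrt_of_sq_le
  rw [← (h r hr).2, ← (h t ht).2]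
  exact sq_norm_sub_le_of_isPositive (h r hr).1 (h t ht).1

/-- A nonnegative operator satisfies the arithmetic-geometric mean inequality. -/
lemma ContinuousLinearMap.IsPositive.two_mul_re_inner_le {N : H →L[𝕜] H} (hN : N.IsPositive)
    (a b : H) :
    2 * RCLike.re ⟪a, N b⟫ ≤ RCLike.re ⟪a, N a⟫ + RCLike.re ⟪b, N b⟫ := by
  have h := hN.re_inner_nonneg_right (a - b)
  have e : RCLike.re ⟪b, N a⟫ = RCLike.re ⟪a, N b⟫ := by
    rw [inner_re_symm]; congr 1; exact hN.1 a b
  simp only [map_sub, inner_sub_left, inner_sub_right] at h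
  rw [e] at h
  linarith

lemma re_inner_apply_self_le (N : H →L[𝕜] H) (x : H) : RCLike.re ⟪x, N x⟫ ≤ ‖N‖ * ‖x‖ ^ 2 := by
  refine (RCLike.re_le_norm _).trans ((norm_inner_le_norm _ _).trans ?_)
  have := mul_le_mul_of_nonneg_left (N.le_opNorm x) (norm_nonneg x)
  linarith

lemma isUnit_of_coercive [CompleteSpace H] {N : H →L[𝕜] H} {δ : ℝ} (hδ : 0 < δ)
    (h : ∀ u, δ * ‖u‖ ^ 2 ≤ RCLike.re ⟪u, N u⟫) : IsUnit N := by
  refine N.isUnit_of_forall_le_norm_inner_map (c := ⟨δ, hδ.le⟩) hδ fun x => ?_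
  rw [norm_inner_symm, mul_comm]
  exact (h x).trans (RCLike.re_le_norm _)

lemma apply_inverse_of_coercive [CompleteSpace H] {N : H →L[𝕜] H} {δ : ℝ} (hδ : 0 < δ)
    (h : ∀ u, δ * ‖u‖ ^ 2 ≤ RCLike.re ⟪u, N u⟫) (x : H) : N (N.inverse x) = x := by
  have := Ring.mul_inverse_cancel N (isUnit_of_coercive hδ h)
  rw [ContinuousLinearMap.ringInverse_eq_inverse] at this
  exact congrArg (fun L : H →L[𝕜] H => L x) this

lemma norm_inverse_le_of_coercive [CompleteSpace H] {N : H →L[𝕜] H} {δ : ℝ} (hδ : 0 < δ)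
    (h : ∀ u, δ * ‖u‖ ^ 2 ≤ RCLike.re ⟪u, N u⟫) : ‖N.inverse‖ ≤ 1 / δ := by
  refine ContinuousLinearMap.opNorm_le_bound _ (by positivity) fun x => ?_
  have h1 := apply_inverse_of_coercive hδ h x
  set u := N.inverse x with hu
  have h2 := (h u).trans ((RCLike.re_le_norm _).trans (norm_inner_le_norm _ _))
  rw [h1] at h2
  rw [one_div, inv_mul_eq_div, le_div_iff₀ hδ]
  rcases (norm_nonneg u).eq_or_lt with h0 | h0
  · rw [← h0]; simp
  · nlinarith

end SelfAdjoint

/-! ### Families of operators measurable in the strong operator topology -/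

section StrongMeasurability

variable {𝕜 : Type*} [RCLike 𝕜]
  {E : Type*} [NormedAddCommGroup E] [NormedSpace 𝕜 E]
  {F : Type*} [NormedAddCommGroup F] [NormedSpace 𝕜 F]
  {G : Type*} [NormedAddCommGroup G] [NormedSpace 𝕜 G]

/-- Measurability of `A` in operator norm is not available. For simple `f` the claim reduces to the
pointwise hypothesis on each level set; the general case follows by approximating `f` and using
continuity of each `A a`. -/
lemma aestronglyMeasurable_clm_apply {α : Type*} [MeasurableSpace α] {μ : Measure α}
    {A : α → E →L[𝕜] F} {f : α → E} (hA : ∀ x, AEStronglyMeasurable (fun a => A a x) μ)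
    (hf : AEStronglyMeasurable f μ) : AEStronglyMeasurable (fun a => A a (f a)) μ := by
  have hs : ∀ g : SimpleFunc α E, AEStronglyMeasurable (fun a => A a (g a)) μ := by
    intro g
    induction g using SimpleFunc.induction with
    | const c hs =>
      rename_i s
      refine ((hA c).indicator hs).congr (Filter.Eventually.of_forall fun a => ?_)
      by_cases ha : a ∈ s <;> simp [ha]
    | add _ h₁ h₂ =>
      simp only [SimpleFunc.coe_add, Pi.add_apply, map_add]
      exact h₁.add h₂
  have h1 : AEStronglyMeasurable (fun a => A a (hf.mk f a)) μ :=
    aestronglyMeasurable_of_tendsto_ae Filter.atTop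
      (fun n => hs (hf.stronglyMeasurable_mk.approx n))
      (Filter.Eventually.of_forall fun a =>
        ((A a).continuous.tendsto _).comp (hf.stronglyMeasurable_mk.tendsto_approx a))
  refine h1.congr ?_
  filter_upwards [hf.ae_eq_mk] with a ha
  rw [ha]

/-- Essentially bounded, almost everywhere strongly measurable functions on a set of times. -/
structure EssBounded (s : Set ℝ) (f : ℝ → E) : Prop where
  aesm : AEStronglyMeasurable f (volume.restrict s)
  bdd : ∃ C : ℝ, 0 ≤ C ∧ ∀ᵐ t ∂(volume.restrict s), ‖f t‖ ≤ C

/-- Essentially bounded families of operators that are measurable in the strong operator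
topology. -/
structure StrongBounded (s : Set ℝ) (A : ℝ → E →L[𝕜] F) : Prop where
  aesm : ∀ x, AEStronglyMeasurable (fun t => A t x) (volume.restrict s)
  bdd : ∃ C : ℝ, 0 ≤ C ∧ ∀ᵐ t ∂(volume.restrict s), ‖A t‖ ≤ C

lemma EssBounded.mono {s s' : Set ℝ} {f : ℝ → E} (h : EssBounded s f) (hs : s' ⊆ s) :
    EssBounded s' f :=
  ⟨h.aesm.mono_measure (Measure.restrict_mono hs le_rfl),
    h.bdd.imp fun _ hC => ⟨hC.1, ae_restrict_of_ae_restrict_of_subset hs hC.2⟩⟩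

lemma StrongBounded.mono {s s' : Set ℝ} {A : ℝ → E →L[𝕜] F} (h : StrongBounded s A)
    (hs : s' ⊆ s) : StrongBounded s' A :=
  ⟨fun x => (h.aesm x).mono_measure (Measure.restrict_mono hs le_rfl),
    h.bdd.imp fun _ hC => ⟨hC.1, ae_restrict_of_ae_restrict_of_subset hs hC.2⟩⟩

lemma EssBounded.add {s : Set ℝ} {f g : ℝ → E} (hf : EssBounded s f) (hg : EssBounded s g) :
    EssBounded s (fun t => f t + g t) := by
  obtain ⟨C, hC0, hC⟩ := hf.bdd
  obtain ⟨C', hC0', hC'⟩ := hg.bdd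
  refine ⟨hf.aesm.add hg.aesm, C + C', by positivity, ?_⟩
  filter_upwards [hC, hC'] with t h1 h2
  exact (norm_add_le _ _).trans (add_le_add h1 h2)

lemma StrongBounded.apply {s : Set ℝ} {A : ℝ → E →L[𝕜] F} {f : ℝ → E} (hA : StrongBounded s A)
    (hf : EssBounded s f) : EssBounded s (fun t => A t (f t)) := by
  obtain ⟨C, hC0, hC⟩ := hA.bdd
  obtain ⟨C', hC0', hC'⟩ := hf.bdd
  refine ⟨aestronglyMeasurable_clm_apply hA.aesm hf.aesm, C * C', by positivity, ?_⟩
  filter_upwards [hC, hC'] with t h1 h2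
  exact (A t).le_of_opNorm_le_of_le h1 h2

lemma StrongBounded.add {s : Set ℝ} {A A' : ℝ → E →L[𝕜] F} (hA : StrongBounded s A)
    (hA' : StrongBounded s A') : StrongBounded s (fun t => A t + A' t) := by
  obtain ⟨C, hC0, hC⟩ := hA.bdd
  obtain ⟨C', hC0', hC'⟩ := hA'.bdd
  refine ⟨fun x => (hA.aesm x).add (hA'.aesm x), C + C', by positivity, ?_⟩
  filter_upwards [hC, hC'] with t h1 h2
  exact (norm_add_le _ _).trans (add_le_add h1 h2)

lemma StrongBounded.neg {s : Set ℝ} {A : ℝ → E →L[𝕜] F} (hA : StrongBounded s A) :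
    StrongBounded s (fun t => -A t) := by
  obtain ⟨C, hC0, hC⟩ := hA.bdd
  exact ⟨fun x => (hA.aesm x).neg, C, hC0, by simpa using hC⟩

lemma StrongBounded.sub {s : Set ℝ} {A A' : ℝ → E →L[𝕜] F} (hA : StrongBounded s A)
    (hA' : StrongBounded s A') : StrongBounded s (fun t => A t - A' t) := by
  simpa [sub_eq_add_neg] using hA.add hA'.neg

lemma StrongBounded.comp {s : Set ℝ} {A : ℝ → F →L[𝕜] G} {A' : ℝ → E →L[𝕜] F}
    (hA : StrongBounded s A) (hA' : StrongBounded s A') :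
    StrongBounded s (fun t => A t ∘L A' t) := by
  obtain ⟨C, hC0, hC⟩ := hA.bdd
  obtain ⟨C', hC0', hC'⟩ := hA'.bdd
  refine ⟨fun x => aestronglyMeasurable_clm_apply (A := A) hA.aesm (hA'.aesm x), C * C', by positivity, ?_⟩
  filter_upwards [hC, hC'] with t h1 h2
  exact ((A t).opNorm_comp_le _).trans (by gcongr)

lemma EssBounded.of_continuousOn {a b : ℝ} {f : ℝ → E} (hf : ContinuousOn f (Icc a b)) :
    EssBounded (Icc a b) f := by
  obtain ⟨C, hC⟩ := isCompact_Icc.exists_bound_of_continuousOn hf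
  refine ⟨hf.aestronglyMeasurable measurableSet_Icc, max C 0, le_max_right _ _, ?_⟩
  filter_upwards [ae_restrict_mem measurableSet_Icc] with t ht
  exact (hC t ht).trans (le_max_left _ _)

lemma StrongBounded.of_continuousOn {a b : ℝ} {A : ℝ → E →L[𝕜] F}
    (hA : ContinuousOn A (Icc a b)) : StrongBounded (Icc a b) A := by
  obtain ⟨C, hC⟩ := isCompact_Icc.exists_bound_of_continuousOn hA
  refine ⟨fun x => (hA.clm_apply continuousOn_const).aestronglyMeasurable measurableSet_Icc,
    max C 0, le_max_right _ _, ?_⟩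
  filter_upwards [ae_restrict_mem measurableSet_Icc] with t ht
  exact (hC t ht).trans (le_max_left _ _)

lemma EssBounded.integrableOn {a b : ℝ} {f : ℝ → E} (h : EssBounded (Icc a b) f) :
    IntegrableOn f (Icc a b) := by
  obtain ⟨C, _, hC⟩ := h.bdd
  exact Integrable.of_bound h.aesm C hC

lemma EssBounded.intervalIntegrable {a b : ℝ} {f : ℝ → E} (h : EssBounded (Icc a b) f)
    (hab : a ≤ b) : IntervalIntegrable f volume a b := by
  rw [intervalIntegrable_iff_integrableOn_Ioc_of_le hab]
  exact h.integrableOn.mono_set Ioc_subset_Icc_self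

lemma EssBounded.inner {H : Type*} [NormedAddCommGroup H] [InnerProductSpace 𝕜 H] {s : Set ℝ}
    {f g : ℝ → H} (hf : EssBounded s f) (hg : EssBounded s g) :
    EssBounded s (fun t => inner 𝕜 (f t) (g t)) := by
  obtain ⟨C, hC0, hC⟩ := hf.bdd
  obtain ⟨C', hC0', hC'⟩ := hg.bdd
  refine ⟨hf.aesm.inner hg.aesm, C * C', by positivity, ?_⟩
  filter_upwards [hC, hC'] with t h1 h2
  exact (norm_inner_le_norm _ _).trans (by gcongr)

/-- The functionals `⟨f(t), ·⟩` of an essentially bounded function `f`. -/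
lemma EssBounded.innerSL {H : Type*} [NormedAddCommGroup H] [InnerProductSpace 𝕜 H] {s : Set ℝ}
    {f : ℝ → H} (hf : EssBounded s f) : StrongBounded s (fun t => innerSL 𝕜 (f t)) := by
  obtain ⟨C, hC0, hC⟩ := hf.bdd
  refine ⟨fun x => ?_, C, hC0, by simpa using hC⟩
  simpa using hf.aesm.inner aestronglyMeasurable_const

end StrongMeasurability

/-! ### Evolution operators: bounds, joint measurability, Fubini on a triangle -/

section Evolution

variable {𝕜 : Type*} [RCLike 𝕜]
  {H : Type*} [NormedAddCommGroup H] [InnerProductSpace 𝕜 H]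
  {F : Type*} [NormedAddCommGroup F] [NormedSpace 𝕜 F]

lemma IsEvolutionOperator.mono {I J : Set ℝ} {U : ℝ → ℝ → H →L[𝕜] H}
    (hU : IsEvolutionOperator I U) (hJ : J ⊆ I) : IsEvolutionOperator J U where
  refl t ht := hU.refl t (hJ ht)
  comp s hs r hr t ht := hU.comp s (hJ hs) r (hJ hr) t (hJ ht)
  continuousOn_left s hs x :=
    (hU.continuousOn_left s (hJ hs) x).mono (inter_subset_inter_left _ hJ)
  continuousOn_right t ht x :=
    (hU.continuousOn_right t (hJ ht) x).mono (inter_subset_inter_left _ hJ)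

lemma IsPerturbedEvolutionOperator.mono [NormedSpace ℝ H] {I J : Set ℝ} {Y V : ℝ → ℝ → H →L[𝕜] H}
    {D : ℝ → H →L[𝕜] H} (h : IsPerturbedEvolutionOperator I Y D V) (hJ : J ⊆ I) :
    IsPerturbedEvolutionOperator J Y D V where
  evolution := h.evolution.mono hJ
  integrable s hs t ht := h.integrable s (hJ hs) t (hJ ht)
  eq s hs t ht := h.eq s (hJ hs) t (hJ ht)

lemma IsEvolutionOperator.comp_apply {I : Set ℝ} {U : ℝ → ℝ → H →L[𝕜] H}
    (hU : IsEvolutionOperator I U) {s r t : ℝ} (hs : s ∈ I) (hr : r ∈ I) (ht : t ∈ I)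
    (hsr : s ≤ r) (hrt : r ≤ t) (x : H) : U t r (U r s x) = U t s x :=
  congrArg (fun L : H →L[𝕜] H => L x) (hU.comp s hs r hr t ht hsr hrt)

lemma IsEvolutionOperator.essBounded_left {I : Set ℝ} {U : ℝ → ℝ → H →L[𝕜] H}
    (hU : IsEvolutionOperator I U) {a b : ℝ} (hab : a ≤ b) (hI : Icc a b ⊆ I) (x : H) :
    EssBounded (Icc a b) (fun t => U t a x) :=
  EssBounded.of_continuousOn ((hU.continuousOn_left a (hI (left_mem_Icc.mpr hab)) x).mono
    fun _ ht => ⟨hI ht, ht.1⟩)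

/-- Uniform boundedness principle with one time fixed. Bounds over the whole triangle are obtained
later by Gronwall, for which this supplies the a priori bound. -/
lemma IsEvolutionOperator.exists_bound_right [CompleteSpace H] {I : Set ℝ}
    {U : ℝ → ℝ → H →L[𝕜] H} (hU : IsEvolutionOperator I U) {a b : ℝ} (hab : a ≤ b)
    (hI : Icc a b ⊆ I) : ∃ C, ∀ s ∈ Icc a b, ‖U b s‖ ≤ C := by
  have h := banach_steinhaus (g := fun s : Icc a b => U b s) fun x => by
    obtain ⟨C, hC⟩ := isCompact_Icc.exists_bound_of_continuousOn
      ((hU.continuousOn_right b (hI (right_mem_Icc.mpr hab)) x).mono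
        fun _ ht => ⟨hI ht, ht.2⟩ : ContinuousOn (fun s => U b s x) (Icc a b))
    exact ⟨C, fun s => hC s s.2⟩
  exact h.imp fun C hC s hs => hC ⟨s, hs⟩

lemma IsEvolutionOperator.exists_bound_left [CompleteSpace H] {I : Set ℝ}
    {U : ℝ → ℝ → H →L[𝕜] H} (hU : IsEvolutionOperator I U) {a b : ℝ} (hab : a ≤ b)
    (hI : Icc a b ⊆ I) : ∃ C, ∀ t ∈ Icc a b, ‖U t a‖ ≤ C := by
  have h := banach_steinhaus (g := fun s : Icc a b => U s a) fun x => by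
    obtain ⟨C, hC⟩ := isCompact_Icc.exists_bound_of_continuousOn
      ((hU.continuousOn_left a (hI (left_mem_Icc.mpr hab)) x).mono
        fun _ ht => ⟨hI ht, ht.1⟩ : ContinuousOn (fun s => U s a x) (Icc a b))
    exact ⟨C, fun s => hC s s.2⟩
  exact h.imp fun C hC s hs => hC ⟨s, hs⟩

lemma IsEvolutionOperator.strongBounded_right [CompleteSpace H] {I : Set ℝ}
    {U : ℝ → ℝ → H →L[𝕜] H} (hU : IsEvolutionOperator I U) {a b : ℝ} (hab : a ≤ b)
    (hI : Icc a b ⊆ I) : StrongBounded (Icc a b) (fun s => U b s) := by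
  obtain ⟨C, hC⟩ := hU.exists_bound_right hab hI
  refine ⟨fun x => ?_, max C 0, le_max_right _ _, ?_⟩
  · exact ((hU.continuousOn_right b (hI (right_mem_Icc.mpr hab)) x).mono
      fun _ ht => ⟨hI ht, ht.2⟩ : ContinuousOn (fun s => U b s x) (Icc a b)).aestronglyMeasurable
        measurableSet_Icc
  · filter_upwards [ae_restrict_mem measurableSet_Icc] with t ht
    exact (hC t ht).trans (le_max_left _ _)

/-- An evolution operator, extended from the triangle `r ≤ ρ` to the plane, is jointly strongly
measurable. -/
lemma IsEvolutionOperator.stronglyMeasurable_extend {a b : ℝ} (hab : a ≤ b)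
    {U : ℝ → ℝ → H →L[𝕜] H} (hU : IsEvolutionOperator (Icc a b) U) (x : H) :
    StronglyMeasurable (fun p : ℝ × ℝ =>
      U (max (max a (min b p.1)) (max a (min b p.2))) (max a (min b p.2)) x) := by
  have hmem : ∀ r, max a (min b r) ∈ Icc a b := fun r =>
    ⟨le_max_left _ _, max_le hab (min_le_left _ _)⟩
  have hcl : Continuous fun r => max a (min b r) := by fun_prop
  -- Carathéodory argument: continuity in the later time and measurability in the earlier one
  -- suffice. Above the diagonal the extension is `U r r`, the identity.
  refine stronglyMeasurable_uncurry_of_continuous_of_stronglyMeasurable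
    (u := fun ρ r => U (max (max a (min b ρ)) (max a (min b r))) (max a (min b r)) x)
    (fun r => ?_) (fun ρ => ?_)
  · refine (hU.continuousOn_left _ (hmem r) x).comp_continuous (by fun_prop) fun ρ => ?_
    exact ⟨⟨(hmem r).1.trans (le_max_right _ _), max_le (hmem ρ).2 (hmem r).2⟩,
      mem_Ici.mpr (le_max_right _ _)⟩
  · have h1 : Continuous fun r => U (max a (min b ρ)) (min (max a (min b r)) (max a (min b ρ))) x :=
      (hU.continuousOn_right _ (hmem ρ) x).comp_continuous (by fun_prop) fun r =>
        ⟨⟨le_min (hmem r).1 (hmem ρ).1, (min_le_left _ _).trans (hmem r).2⟩,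
          mem_Iic.mpr (min_le_right _ _)⟩
    have hs : MeasurableSet {r | max a (min b r) ≤ max a (min b ρ)} :=
      measurableSet_le hcl.measurable measurable_const
    have h2 : StronglyMeasurable fun r => if max a (min b r) ≤ max a (min b ρ) then
        U (max a (min b ρ)) (min (max a (min b r)) (max a (min b ρ))) x else x :=
      StronglyMeasurable.ite hs h1.stronglyMeasurable stronglyMeasurable_const
    convert h2 using 1
    ext r
    by_cases hr : max a (min b r) ≤ max a (min b ρ)
    · rw [if_pos hr, max_eq_left hr, min_eq_left hr]
    · rw [if_neg hr, max_eq_right (not_le.mp hr).le, hU.refl _ (hmem r)]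
      rfl

/-- The kernel `U(ρ,r) f(r)` on the triangle `r ≤ ρ`, extended by zero. -/
lemma IsEvolutionOperator.aestronglyMeasurable_kernel {a b : ℝ} (hab : a ≤ b)
    {U : ℝ → ℝ → H →L[𝕜] H} (hU : IsEvolutionOperator (Icc a b) U)
    {f : ℝ → H} (hf : EssBounded (Icc a b) f) :
    AEStronglyMeasurable (fun p : ℝ × ℝ => if p.2 ≤ p.1 then U p.1 p.2 (f p.2) else 0)
      ((volume.restrict (Ioc a b)).prod (volume.restrict (Ioc a b))) := by
  have hf' := hf.mono Ioc_subset_Icc_self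
  have hcl : ∀ r ∈ Ioc a b, max a (min b r) = r := fun r hr => by
    rw [min_eq_right hr.2, max_eq_right hr.1.le]
  have hset : MeasurableSet {p : ℝ × ℝ | p.2 ≤ p.1} := measurableSet_le measurable_snd measurable_fst
  have h1 := aestronglyMeasurable_clm_apply (A := fun p : ℝ × ℝ =>
    U (max (max a (min b p.1)) (max a (min b p.2))) (max a (min b p.2)))
    (μ := (volume.restrict (Ioc a b)).prod (volume.restrict (Ioc a b)))
    (fun x => (hU.stronglyMeasurable_extend hab x).aestronglyMeasurable) hf'.aesm.comp_snd
  refine (h1.indicator hset).congr ?_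
  rw [Measure.prod_restrict]
  filter_upwards [ae_restrict_mem (measurableSet_Ioc.prod measurableSet_Ioc)] with p hp
  by_cases h : p.2 ≤ p.1
  · simp only [indicator, mem_ofPred_eq, h, if_true, hcl _ hp.1, hcl _ hp.2, max_eq_left]
  · simp [indicator, h]

lemma Ioc_inter_Iic_of_le {a b ρ : ℝ} (hρ : ρ ≤ b) : Ioc a b ∩ Iic ρ = Ioc a ρ := by
  ext r
  exact ⟨fun h => ⟨h.1.1, h.2⟩, fun h => ⟨⟨h.1, h.2.trans hρ⟩, h.2⟩⟩

/-- Measurability in `ρ` comes from integrating out one variable of the triangle kernel, which is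
jointly measurable on the square. -/
lemma IsEvolutionOperator.essBounded_integral [NormedSpace ℝ H] [CompleteSpace H]
    {a b M : ℝ} (hab : a ≤ b) {U : ℝ → ℝ → H →L[𝕜] H} (hU : IsEvolutionOperator (Icc a b) U)
    (hM : ∀ s t, a ≤ s → s ≤ t → t ≤ b → ‖U t s‖ ≤ M)
    {f : ℝ → H} (hf : EssBounded (Icc a b) f) :
    EssBounded (Icc a b) (fun ρ => ∫ r in a..ρ, U ρ r (f r)) := by
  have hM0 : 0 ≤ M := (norm_nonneg _).trans (hM a a le_rfl le_rfl hab)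
  obtain ⟨C, hC0, hC⟩ := hf.bdd
  constructor
  · rw [← restrict_Ioc_eq_restrict_Icc]
    refine (hU.aestronglyMeasurable_kernel hab hf).integral_prod_right'.congr ?_
    filter_upwards [ae_restrict_mem measurableSet_Ioc] with ρ hρ
    have e : (fun r => if r ≤ ρ then U ρ r (f r) else 0)
        = (Iic ρ).indicator (fun r => U ρ r (f r)) := by
      ext r; simp [indicator]
    simp only [e]
    rw [setIntegral_indicator measurableSet_Iic, Ioc_inter_Iic_of_le hρ.2,
      ← intervalIntegral.integral_of_le hρ.1.le]
  · refine ⟨M * C * (b - a), mul_nonneg (by positivity) (sub_nonneg.mpr hab), ?_⟩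
    filter_upwards [ae_restrict_mem measurableSet_Icc] with ρ hρ
    rw [ae_restrict_iff' measurableSet_Icc] at hC
    have h := intervalIntegral.norm_integral_le_of_norm_le (f := fun r => U ρ r (f r))
      (g := fun _ => M * C) (μ := volume) hρ.1 (by
        filter_upwards [hC] with r hr hr'
        exact (U ρ r).le_of_opNorm_le_of_le (hM _ _ hr'.1.le hr'.2 hρ.2)
          (hr ⟨hr'.1.le, hr'.2.trans hρ.2⟩)) (by simp)
    rw [intervalIntegral.integral_const, smul_eq_mul] at h
    refine h.trans ?_
    rw [mul_comm]
    exact mul_le_mul_of_nonneg_left (by linarith [hρ.2]) (by positivity)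

/-- Interchange of the order of integration over a triangle for the kernel of an evolution
operator. -/
lemma IsEvolutionOperator.integral_triangle_swap [NormedSpace ℝ H] [CompleteSpace H]
    [NormedSpace ℝ F] [CompleteSpace F]
    {a b M : ℝ} (hab : a ≤ b) {U : ℝ → ℝ → H →L[𝕜] H} (hU : IsEvolutionOperator (Icc a b) U)
    (hM : ∀ s t, a ≤ s → s ≤ t → t ≤ b → ‖U t s‖ ≤ M)
    {A : ℝ → H →L[𝕜] F} (hA : StrongBounded (Icc a b) A)
    {f : ℝ → H} (hf : EssBounded (Icc a b) f) :
    ∫ ρ in a..b, A ρ (∫ r in a..ρ, U ρ r (f r)) = ∫ r in a..b, ∫ ρ in r..b, A ρ (U ρ r (f r)) := by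
  have hM0 : 0 ≤ M := (norm_nonneg _).trans (hM a a le_rfl le_rfl hab)
  set μ := volume.restrict (Ioc a b) with hμ
  have hA' := hA.mono Ioc_subset_Icc_self
  obtain ⟨C, hC0, hC⟩ := hA'.bdd
  obtain ⟨C', hC0', hC'⟩ := (hf.mono Ioc_subset_Icc_self).bdd
  let k : ℝ → ℝ → F := fun ρ r => A ρ (if r ≤ ρ then U ρ r (f r) else 0)
  have hk : AEStronglyMeasurable (Function.uncurry k) (μ.prod μ) :=
    aestronglyMeasurable_clm_apply (A := fun p : ℝ × ℝ => A p.1)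
      (fun x => (hA'.aesm x).comp_fst) (hU.aestronglyMeasurable_kernel hab hf)
  have hbd : ∀ᵐ p ∂(μ.prod μ), ‖Function.uncurry k p‖ ≤ C * (M * C') := by
    have h1 : ∀ᵐ p ∂(μ.prod μ), ‖A p.1‖ ≤ C := Measure.quasiMeasurePreserving_fst.ae hC
    have h2 : ∀ᵐ p ∂(μ.prod μ), ‖f p.2‖ ≤ C' := Measure.quasiMeasurePreserving_snd.ae hC'
    have hmem : ∀ᵐ p ∂(μ.prod μ), p.1 ∈ Ioc a b ∧ p.2 ∈ Ioc a b := by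
      rw [hμ, Measure.prod_restrict]
      filter_upwards [ae_restrict_mem (measurableSet_Ioc.prod measurableSet_Ioc)] with p hp
      exact hp
    filter_upwards [hmem, h1, h2] with p hp h1 h2
    refine (A p.1).le_of_opNorm_le_of_le h1 ?_
    split_ifs with h
    · exact (U p.1 p.2).le_of_opNorm_le_of_le (hM _ _ hp.2.1.le h hp.1.2) h2
    · rw [norm_zero]; positivity
  have hint : Integrable (Function.uncurry k) (μ.prod μ) := Integrable.of_bound hk _ hbd
  have hswap := integral_integral_swap hint
  rw [intervalIntegral.integral_of_le hab, intervalIntegral.integral_of_le hab]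
  have hl : ∫ ρ in Ioc a b, A ρ (∫ r in a..ρ, U ρ r (f r)) = ∫ ρ, ∫ r, k ρ r ∂μ ∂μ := by
    refine setIntegral_congr_fun measurableSet_Ioc fun ρ hρ => ?_
    have e : (fun r => k ρ r) = (Iic ρ).indicator (fun r => A ρ (U ρ r (f r))) := by
      ext r; by_cases h : r ≤ ρ <;> simp [k, indicator, h]
    have hsub : Icc a ρ ⊆ Icc a b := Icc_subset_Icc_right hρ.2
    have hi := (((hU.strongBounded_right hρ.1.le hsub).apply (hf.mono hsub)).intervalIntegrable
      hρ.1.le)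
    rw [e, hμ, setIntegral_indicator measurableSet_Iic, Ioc_inter_Iic_of_le hρ.2,
      ← intervalIntegral.integral_of_le hρ.1.le,
      ContinuousLinearMap.intervalIntegral_comp_comm _ hi]
  have hr : ∫ r in Ioc a b, ∫ ρ in r..b, A ρ (U ρ r (f r)) = ∫ r, ∫ ρ, k ρ r ∂μ ∂μ := by
    refine setIntegral_congr_fun measurableSet_Ioc fun r hr => ?_
    have e : (fun ρ => k ρ r) = (Ici r).indicator (fun ρ => A ρ (U ρ r (f r))) := by
      ext ρ; by_cases h : r ≤ ρ <;> simp [k, indicator, h]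
    have e2 : Ioc a b ∩ Ici r = Icc r b := by
      ext ρ
      exact ⟨fun h => ⟨h.2, h.1.2⟩, fun h => ⟨⟨hr.1.trans_le h.1, h.2⟩, h.1⟩⟩
    rw [e, hμ, setIntegral_indicator measurableSet_Ici, e2, integral_Icc_eq_integral_Ioc,
      ← intervalIntegral.integral_of_le hr.2]
  rw [hl, hr, hswap]

end Evolution

/-! ### Perturbed evolution operators and variation of constants -/

section Perturbation

variable {𝕜 : Type*} [RCLike 𝕜]
  {H : Type*} [NormedAddCommGroup H] [InnerProductSpace 𝕜 H] [NormedSpace ℝ H] [CompleteSpace H]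

lemma ae_imp_of_ae_restrict_Icc {T a b : ℝ} {p : ℝ → Prop}
    (h : ∀ᵐ r ∂(volume.restrict (Icc 0 T)), p r) (ha : 0 ≤ a) (hb : b ≤ T) :
    ∀ᵐ r, r ∈ Ioc a b → p r := by
  rw [ae_restrict_iff' measurableSet_Icc] at h
  filter_upwards [h] with r hr hr'
  exact hr ⟨ha.trans hr'.1.le, hr'.2.trans hb⟩

lemma norm_integral_le_mul_integral {E : Type*} [NormedAddCommGroup E] [NormedSpace ℝ E]
    {a b C : ℝ} (hab : a ≤ b) {f : ℝ → E} {g : ℝ → ℝ} (hg : Continuous g)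
    (h : ∀ᵐ r, r ∈ Ioc a b → ‖f r‖ ≤ C * g r) :
    ‖∫ r in a..b, f r‖ ≤ C * ∫ r in a..b, g r := by
  rw [← intervalIntegral.integral_const_mul]
  exact intervalIntegral.norm_integral_le_of_norm_le hab h
    (Continuous.intervalIntegrable (by fun_prop) _ _)

/-- If a bounded perturbation of `Y` is uniformly bounded, then so is `Y` on compact triangles. -/
lemma IsPerturbedEvolutionOperator.exists_bound_unperturbed {T M c : ℝ} (hT : 0 ≤ T)
    {Y V : ℝ → ℝ → H →L[𝕜] H}
    {D : ℝ → H →L[𝕜] H} (hY : IsEvolutionOperator (Icc 0 T) Y)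
    (h : IsPerturbedEvolutionOperator (Icc 0 T) Y D V) (hc0 : 0 ≤ c)
    (hc : ∀ᵐ r ∂(volume.restrict (Icc 0 T)), ‖D r‖ ≤ c)
    (hM : ∀ s t, 0 ≤ s → s ≤ t → t ≤ T → ‖V t s‖ ≤ M) :
    ∃ M', ∀ s t, 0 ≤ s → s ≤ t → t ≤ T → ‖Y t s‖ ≤ M' := by
  have hM0 : 0 ≤ M := (norm_nonneg _).trans (hM 0 0 le_rfl le_rfl hT)
  refine ⟨2 * M * Real.exp ((2 * (c * M) + 1) * T), fun s t hs hst htT => ?_⟩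
  have ht0 : 0 ≤ t := hs.trans hst
  obtain ⟨C, hC⟩ := hY.exists_bound_right ht0 (Icc_subset_Icc_right htT)
  -- Solved for `Y(t,s)`, the perturbation equation involves only `V` and `Y(t,r)` with `s ≤ r ≤ t`,
  -- so Gronwall runs in the earlier time, backward from `t`.
  have key := gronwall_backward (f := fun s => ‖Y t s‖) hM0 (mul_nonneg hc0 hM0) hC
    (fun g hg hg0 hfg s hs => by
      have hi0 : 0 ≤ ∫ r in s..t, g r :=
        intervalIntegral.integral_nonneg hs.2 fun r _ => hg0 r
      refine ContinuousLinearMap.opNorm_le_bound _ (by positivity) fun w => ?_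
      have e := h.eq s ⟨hs.1, hs.2.trans htT⟩ t ⟨ht0, htT⟩ hs.2 w
      have e' : Y t s w = V t s w - ∫ r in s..t, Y t r (D r (V r s w)) := by rw [e]; abel
      rw [e']
      refine (norm_sub_le _ _).trans ?_
      have h1 := (V t s).le_of_opNorm_le (hM s t hs.1 hs.2 htT) w
      have h2 := norm_integral_le_mul_integral (C := c * M * ‖w‖) hs.2 hg
        (f := fun r => Y t r (D r (V r s w))) (by
          filter_upwards [ae_imp_of_ae_restrict_Icc hc hs.1 htT] with r hr hr'
          have h3 := (V r s).le_of_opNorm_le (hM s r hs.1 hr'.1.le (hr'.2.trans htT)) w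
          have h4 := (Y t r).le_of_opNorm_le_of_le (hfg r ⟨hs.1.trans hr'.1.le, hr'.2⟩)
            ((D r).le_of_opNorm_le_of_le (hr hr') h3)
          linarith)
      linarith) s ⟨hs, hst⟩
  refine key.trans ?_
  gcongr
  linarith

/-- An essentially bounded perturbation of a bounded evolution operator is bounded on compact
triangles. -/
lemma IsPerturbedEvolutionOperator.exists_bound {T M c : ℝ} (hT : 0 ≤ T)
    {Y V : ℝ → ℝ → H →L[𝕜] H} {D : ℝ → H →L[𝕜] H}
    (h : IsPerturbedEvolutionOperator (Icc 0 T) Y D V) (hc0 : 0 ≤ c)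
    (hc : ∀ᵐ r ∂(volume.restrict (Icc 0 T)), ‖D r‖ ≤ c)
    (hM : ∀ s t, 0 ≤ s → s ≤ t → t ≤ T → ‖Y t s‖ ≤ M) :
    ∃ M', ∀ s t, 0 ≤ s → s ≤ t → t ≤ T → ‖V t s‖ ≤ M' := by
  have hM0 : 0 ≤ M := (norm_nonneg _).trans (hM 0 0 le_rfl le_rfl hT)
  refine ⟨2 * M * Real.exp ((2 * (M * c) + 1) * T), fun s t hs hst htT => ?_⟩
  obtain ⟨C, hC⟩ := h.evolution.exists_bound_left (hst.trans htT) (Icc_subset_Icc_left hs)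
  have key := gronwall_forward (f := fun t => ‖V t s‖) hM0 (mul_nonneg hM0 hc0) hC
    (fun g hg hg0 hfg t ht => by
      have hi0 : 0 ≤ ∫ r in s..t, g r :=
        intervalIntegral.integral_nonneg ht.1 fun r _ => hg0 r
      refine ContinuousLinearMap.opNorm_le_bound _ (by positivity) fun w => ?_
      rw [h.eq s ⟨hs, ht.1.trans ht.2⟩ t ⟨hs.trans ht.1, ht.2⟩ ht.1 w]
      refine (norm_add_le _ _).trans ?_
      have h1 := (Y t s).le_of_opNorm_le (hM s t hs ht.1 ht.2) w
      have h2 := norm_integral_le_mul_integral (C := M * c * ‖w‖) ht.1 hg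
        (f := fun r => Y t r (D r (V r s w))) (by
          filter_upwards [ae_imp_of_ae_restrict_Icc hc hs ht.2] with r hr hr'
          have h3 := (V r s).le_of_opNorm_le (hfg r ⟨hr'.1.le, hr'.2.trans ht.2⟩) w
          have h4 := (Y t r).le_of_opNorm_le_of_le (hM r t (hs.trans hr'.1.le) hr'.2 ht.2)
            ((D r).le_of_opNorm_le_of_le (hr hr') h3)
          linarith)
      linarith) t ⟨hst, htT⟩
  refine key.trans ?_
  gcongr
  linarith

/-- Two perturbations of the same evolution operator are perturbations of each other. -/
lemma IsPerturbedEvolutionOperator.eq_add_integral {T M : ℝ} {Y U₁ U₂ : ℝ → ℝ → H →L[𝕜] H}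
    {D₁ D₂ : ℝ → H →L[𝕜] H} (hY : IsEvolutionOperator (Icc 0 T) Y)
    (h₁ : IsPerturbedEvolutionOperator (Icc 0 T) Y D₁ U₁)
    (h₂ : IsPerturbedEvolutionOperator (Icc 0 T) Y D₂ U₂)
    (hMY : ∀ s t, 0 ≤ s → s ≤ t → t ≤ T → ‖Y t s‖ ≤ M)
    (hM₁ : ∀ s t, 0 ≤ s → s ≤ t → t ≤ T → ‖U₁ t s‖ ≤ M)
    (hD₁ : StrongBounded (Icc 0 T) D₁) (hD₂ : StrongBounded (Icc 0 T) D₂)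
    {s t : ℝ} (hs : 0 ≤ s) (hst : s ≤ t) (htT : t ≤ T) (x : H) :
    U₂ t s x = U₁ t s x + ∫ r in s..t, U₁ t r ((D₂ r - D₁ r) (U₂ r s x)) := by
  have hsT : s ≤ T := hst.trans htT
  have hM0 : 0 ≤ M := (norm_nonneg _).trans (hMY s s hs le_rfl hsT)
  have hsub : Icc s T ⊆ Icc 0 T := Icc_subset_Icc_left hs
  obtain ⟨c, hc0, hc⟩ := hD₁.bdd
  have bU₁ : EssBounded (Icc s T) (fun r => U₁ r s x) := h₁.evolution.essBounded_left hsT hsub x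
  have bU₂ : EssBounded (Icc s T) (fun r => U₂ r s x) := h₂.evolution.essBounded_left hsT hsub x
  set g : ℝ → H := fun r => (D₂ r - D₁ r) (U₂ r s x) with hg
  have bg : EssBounded (Icc s T) g := ((hD₂.sub hD₁).mono hsub).apply bU₂
  set ξ : ℝ → H := fun ρ => ∫ r in s..ρ, U₁ ρ r (g r) with hξ
  have bξ : EssBounded (Icc s T) ξ :=
    (h₁.evolution.mono hsub).essBounded_integral hsT (fun a b ha => hM₁ a b (hs.trans ha)) bg
  -- The defect of the claimed identity. It solves the homogeneous Volterra equation `e = ∫ Y D₁ e`,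
  -- hence vanishes by Gronwall with `A = 0`.
  set e : ℝ → H := fun r => U₂ r s x - U₁ r s x - ξ r with he
  have hrep : ∀ τ ∈ Icc s T, e τ = ∫ r in s..τ, Y τ r (D₁ r (e r)) := by
    intro τ hτ
    have hsubτ : Icc s τ ⊆ Icc s T := Icc_subset_Icc_right hτ.2
    have hsubτ' : Icc s τ ⊆ Icc 0 T := hsubτ.trans hsub
    have hs0 : s ∈ Icc 0 T := ⟨hs, hsT⟩
    have hτ0 : τ ∈ Icc 0 T := hsub hτ
    have bYD : ∀ {D : ℝ → H →L[𝕜] H}, StrongBounded (Icc 0 T) D →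
        StrongBounded (Icc s τ) (fun r => Y τ r ∘L D r) := fun hD =>
      (hY.strongBounded_right hτ.1 hsubτ').comp (hD.mono hsubτ')
    have i1 : IntervalIntegrable (fun r => Y τ r (D₁ r (U₁ r s x))) volume s τ :=
      h₁.integrable s hs0 τ hτ0 hτ.1 x
    have i2 : IntervalIntegrable (fun r => Y τ r (D₂ r (U₂ r s x))) volume s τ :=
      h₂.integrable s hs0 τ hτ0 hτ.1 x
    have i3 : IntervalIntegrable (fun r => Y τ r (D₁ r (U₂ r s x))) volume s τ :=
      ((bYD hD₁).apply (bU₂.mono hsubτ)).intervalIntegrable hτ.1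
    have i4 : IntervalIntegrable (fun r => Y τ r (D₁ r (ξ r))) volume s τ :=
      ((bYD hD₁).apply (bξ.mono hsubτ)).intervalIntegrable hτ.1
    have hfub : ∫ ρ in s..τ, Y τ ρ (D₁ ρ (ξ ρ))
        = ∫ r in s..τ, ∫ ρ in r..τ, Y τ ρ (D₁ ρ (U₁ ρ r (g r))) :=
      (h₁.evolution.mono hsubτ').integral_triangle_swap hτ.1
        (fun a b ha hab hb => hM₁ a b (hs.trans ha) hab (hb.trans hτ.2)) (bYD hD₁)
        (bg.mono hsubτ)
    have hYg : IntervalIntegrable (fun r => Y τ r (g r)) volume s τ :=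
      (((hY.strongBounded_right hτ.1 hsubτ')).apply (bg.mono hsubτ)).intervalIntegrable hτ.1
    have hUg : IntervalIntegrable (fun r => U₁ τ r (g r)) volume s τ :=
      (((h₁.evolution.strongBounded_right hτ.1 hsubτ')).apply
        (bg.mono hsubτ)).intervalIntegrable hτ.1
    -- After the interchange of integrals, the inner integral is the perturbation equation of `U₁`
    -- started at `r` from `g r`.
    have hξτ : ξ τ = (∫ r in s..τ, Y τ r (g r)) + ∫ r in s..τ, Y τ r (D₁ r (ξ r)) := by
      rw [hfub, ← sub_eq_iff_eq_add', ← intervalIntegral.integral_sub hUg hYg]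
      refine intervalIntegral.integral_congr fun r hr => ?_
      rw [uIcc_of_le hτ.1] at hr
      rw [h₁.eq r (hsubτ' hr) τ hτ0 hr.2 (g r)]
      abel
    have hYg' : ∫ r in s..τ, Y τ r (g r)
        = (∫ r in s..τ, Y τ r (D₂ r (U₂ r s x))) - ∫ r in s..τ, Y τ r (D₁ r (U₂ r s x)) := by
      rw [← intervalIntegral.integral_sub i2 i3]
      refine intervalIntegral.integral_congr fun r _ => ?_
      simp [hg]
    have hrhs : ∫ r in s..τ, Y τ r (D₁ r (e r))
        = (∫ r in s..τ, Y τ r (D₁ r (U₂ r s x))) - (∫ r in s..τ, Y τ r (D₁ r (U₁ r s x)))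
          - ∫ r in s..τ, Y τ r (D₁ r (ξ r)) := by
      rw [← intervalIntegral.integral_sub i3 i1, ← intervalIntegral.integral_sub (i3.sub i1) i4]
      refine intervalIntegral.integral_congr fun r _ => ?_
      simp [he]
    rw [hrhs]
    simp only [he]
    rw [hξτ, hYg', h₁.eq s hs0 τ hτ0 hτ.1 x, h₂.eq s hs0 τ hτ0 hτ.1 x]
    abel
  obtain ⟨Cξ, hCξ⟩ : ∃ C, ∀ τ ∈ Icc s T, ‖ξ τ‖ ≤ C := by
    obtain ⟨c', hc0', hc'⟩ := bg.bdd
    refine ⟨M * c' * (T - s), fun τ hτ => ?_⟩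
    rw [ae_restrict_iff' measurableSet_Icc] at hc'
    have h := norm_integral_le_mul_integral (C := M * c') (g := fun _ => 1) hτ.1
      continuous_const (f := fun r => U₁ τ r (g r)) (by
        filter_upwards [hc'] with r hr hr'
        rw [mul_one]
        exact (U₁ τ r).le_of_opNorm_le_of_le (hM₁ r τ (hs.trans hr'.1.le) hr'.2 hτ.2)
          (hr ⟨hr'.1.le, hr'.2.trans hτ.2⟩))
    rw [intervalIntegral.integral_const, smul_eq_mul, mul_one] at h
    exact h.trans (mul_le_mul_of_nonneg_left (by linarith [hτ.2]) (by positivity))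
  obtain ⟨C₁, hC₁⟩ := h₁.evolution.exists_bound_left hsT hsub
  obtain ⟨C₂, hC₂⟩ := h₂.evolution.exists_bound_left hsT hsub
  have hzero := gronwall_forward (f := fun r => ‖e r‖) (A := 0) (C := M * c)
    (M := C₂ * ‖x‖ + C₁ * ‖x‖ + Cξ) le_rfl (mul_nonneg hM0 hc0)
    (fun τ hτ => (norm_sub_le _ _).trans (add_le_add ((norm_sub_le _ _).trans (add_le_add
      ((U₂ τ s).le_of_opNorm_le (hC₂ τ hτ) x) ((U₁ τ s).le_of_opNorm_le (hC₁ τ hτ) x)))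
      (hCξ τ hτ)))
    (fun γ hγ _ hfγ τ hτ => by
      rw [hrep τ hτ, zero_add]
      refine norm_integral_le_mul_integral hτ.1 hγ ?_
      filter_upwards [ae_imp_of_ae_restrict_Icc hc hs hτ.2] with r hr hr'
      rw [mul_assoc]
      exact (Y τ r).le_of_opNorm_le_of_le (hMY r τ (hs.trans hr'.1.le) hr'.2 hτ.2)
        ((D₁ r).le_of_opNorm_le_of_le (hr hr') (hfγ r ⟨hr'.1.le, hr'.2.trans hτ.2⟩)))
    t ⟨hst, htT⟩
  have he0 : e t = 0 := by
    apply norm_le_zero_iff.mp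
    simpa using hzero
  simp only [he, hξ, hg] at he0
  rw [sub_eq_zero] at he0
  rw [← he0]
  abel

end Perturbation

/-! ### Integral Lyapunov equation: symmetry, cost identity, minimality -/

section Lyapunov

variable {𝕜 : Type*} [RCLike 𝕜]
  {H : Type*} [NormedAddCommGroup H] [InnerProductSpace 𝕜 H]
  {X : Type*} [NormedAddCommGroup X] [InnerProductSpace 𝕜 X]

local notation "⟪" x ", " y "⟫" => inner 𝕜 x y

/-- The weak form of the integral Lyapunov equation with terminal value `P₀` and right hand side
`Q` along the evolution operator `V`. -/
def IsLyapunovSolution (T : ℝ) (V : ℝ → ℝ → H →L[𝕜] H) (P₀ : H →L[𝕜] H) (Q P : ℝ → H →L[𝕜] H) :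
    Prop :=
  ∀ s ∈ Icc 0 T, ∀ x y : H, ⟪y, P s x⟫ =
    ⟪V T s y, P₀ (V T s x)⟫ + ∫ r in s..T, ⟪V r s y, Q r (V r s x)⟫

lemma intervalIntegral_re {a b : ℝ} {f : ℝ → 𝕜} (hf : IntervalIntegrable f volume a b) :
    ∫ r in a..b, RCLike.re (f r) = RCLike.re (∫ r in a..b, f r) :=
  (RCLike.reCLM (K := 𝕜)).intervalIntegral_comp_comm hf

/-- The value of the quadratic cost along the closed loop. -/
lemma IsLyapunovSolution.cost_eq {T : ℝ} {V : ℝ → ℝ → H →L[𝕜] H} {P₀ : H →L[𝕜] H}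
    {Q P W : ℝ → H →L[𝕜] H} {K : ℝ → H →L[𝕜] X} {R : ℝ → X →L[𝕜] X}
    (hP : IsLyapunovSolution T V P₀ Q P)
    (hV : IsEvolutionOperator (Icc 0 T) V) (bQ : StrongBounded (Icc 0 T) Q)
    (hQ : ∀ r ∈ Icc 0 T, ∀ x y, ⟪y, Q r x⟫ = ⟪y, W r x⟫ + ⟪K r y, R r (K r x)⟫)
    {s : ℝ} (hs : s ∈ Icc 0 T) (x : H) :
    RCLike.re ⟪x, P s x⟫ = RCLike.re ⟪V T s x, P₀ (V T s x)⟫ +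
      ∫ r in s..T, (RCLike.re ⟪V r s x, W r (V r s x)⟫ +
        RCLike.re ⟪K r (V r s x), R r (K r (V r s x))⟫) := by
  have hsub : Icc s T ⊆ Icc 0 T := Icc_subset_Icc_left hs.1
  have bV : EssBounded (Icc s T) (fun r => V r s x) := hV.essBounded_left hs.2 hsub x
  have i1 := (bV.inner (𝕜 := 𝕜) ((bQ.mono hsub).apply bV)).intervalIntegrable hs.2
  rw [hP s hs x x, map_add, ← intervalIntegral_re i1]
  congr 1
  refine intervalIntegral.integral_congr fun r hr => ?_
  rw [uIcc_of_le hs.2] at hr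
  simp only [hQ r (hsub hr), map_add]

lemma opNorm_le_of_norm_inner_le {A : H →L[𝕜] H} {C : ℝ} (hC : 0 ≤ C)
    (h : ∀ x y, ‖⟪y, A x⟫‖ ≤ C * ‖x‖ * ‖y‖) : ‖A‖ ≤ C := by
  refine A.opNorm_le_bound hC fun x => ?_
  have h1 := h x (A x)
  rw [inner_self_eq_norm_sq_to_K, norm_pow, RCLike.norm_ofReal, abs_norm, sq] at h1
  rcases (norm_nonneg (A x)).eq_or_lt with h0 | h0
  · rw [← h0]; positivity
  · exact le_of_mul_le_mul_right h1 h0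

/-- An essential bound on `Q` gives a bound on `P` at every time, since the equation holds at every
`s`. Gronwall in the symmetry proof needs such a pointwise bound. -/
lemma IsLyapunovSolution.exists_bound {T M : ℝ} {V : ℝ → ℝ → H →L[𝕜] H} {P₀ : H →L[𝕜] H}
    {Q P : ℝ → H →L[𝕜] H} (hP : IsLyapunovSolution T V P₀ Q P)
    (hM0 : 0 ≤ M) (hM : ∀ s t, 0 ≤ s → s ≤ t → t ≤ T → ‖V t s‖ ≤ M)
    (bQ : StrongBounded (Icc 0 T) Q) : ∃ C, 0 ≤ C ∧ ∀ s ∈ Icc 0 T, ‖P s‖ ≤ C := by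
  obtain ⟨q, hq0, hq⟩ := bQ.bdd
  refine ⟨M * ‖P₀‖ * M + M * q * M * |T|, by positivity, fun s hs => ?_⟩
  refine opNorm_le_of_norm_inner_le (by positivity) fun x y => ?_
  rw [hP s hs x y]
  refine (norm_add_le _ _).trans ?_
  have hT := hM s T hs.1 hs.2 le_rfl
  have h1 : ‖⟪V T s y, P₀ (V T s x)⟫‖ ≤ (M * ‖y‖) * (‖P₀‖ * (M * ‖x‖)) :=
    (norm_inner_le_norm _ _).trans (mul_le_mul ((V T s).le_of_opNorm_le hT y)
      (P₀.le_of_opNorm_le_of_le le_rfl ((V T s).le_of_opNorm_le hT x)) (norm_nonneg _)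
      (by positivity))
  have h2 := norm_integral_le_mul_integral (C := (M * ‖y‖) * (q * (M * ‖x‖))) (g := fun _ => 1)
    hs.2 continuous_const (f := fun r => ⟪V r s y, Q r (V r s x)⟫) (by
      filter_upwards [ae_imp_of_ae_restrict_Icc hq hs.1 le_rfl] with r hr hr'
      have hVr := hM s r hs.1 hr'.1.le hr'.2
      rw [mul_one]
      exact (norm_inner_le_norm _ _).trans (mul_le_mul ((V r s).le_of_opNorm_le hVr y)
        ((Q r).le_of_opNorm_le_of_le (hr hr') ((V r s).le_of_opNorm_le hVr x)) (norm_nonneg _)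
        (by positivity)))
  rw [intervalIntegral.integral_const, smul_eq_mul, mul_one] at h2
  have h3 : (M * ‖y‖) * (q * (M * ‖x‖)) * (T - s) ≤ (M * ‖y‖) * (q * (M * ‖x‖)) * |T| :=
    mul_le_mul_of_nonneg_left ((sub_le_self _ hs.1).trans (le_abs_self _)) (by positivity)
  linarith

variable [CompleteSpace H]

/-- Solutions of an integral Riccati equation with symmetric data are symmetric. -/
lemma IsLyapunovSolution.symmetric {T M n : ℝ} {V : ℝ → ℝ → H →L[𝕜] H} {P₀ : H →L[𝕜] H}
    {Q P W N : ℝ → H →L[𝕜] H} (hP : IsLyapunovSolution T V P₀ Q P)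
    (hV : IsEvolutionOperator (Icc 0 T) V)
    (hM : ∀ s t, 0 ≤ s → s ≤ t → t ≤ T → ‖V t s‖ ≤ M)
    (bQ : StrongBounded (Icc 0 T) Q) (hQ : ∀ r ∈ Icc 0 T, ∀ x, Q r x = W r x + P r (N r (P r x)))
    (hP₀ : ∀ x y, ⟪P₀ x, y⟫ = ⟪x, P₀ y⟫) (hW : ∀ r ∈ Icc 0 T, ∀ x y, ⟪W r x, y⟫ = ⟪x, W r y⟫)
    (hN : ∀ r ∈ Icc 0 T, ∀ x y, ⟪N r x, y⟫ = ⟪x, N r y⟫) (hn : ∀ r ∈ Icc 0 T, ‖N r‖ ≤ n) :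
    ∀ s ∈ Icc 0 T, ∀ x y, ⟪P s x, y⟫ = ⟪x, P s y⟫ := by
  intro s hs
  have hT0 : 0 ≤ T := hs.1.trans hs.2
  have hM0 : 0 ≤ M := (norm_nonneg _).trans (hM 0 0 le_rfl le_rfl hT0)
  have hn0 : 0 ≤ n := (norm_nonneg _).trans (hn s hs)
  obtain ⟨p, hp0, hp⟩ := hP.exists_bound hM0 hM bQ
  set Δ : ℝ → H →L[𝕜] H := fun s => P s - (P s).adjoint with hΔ
  have hΔin : ∀ s x y, ⟪y, Δ s x⟫ = ⟪y, P s x⟫ - ⟪P s y, x⟫ := by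
    intro s x y
    simp [hΔ, inner_sub_right, ContinuousLinearMap.adjoint_inner_right]
  have hbd : ∀ s ∈ Icc 0 T, ‖Δ s‖ ≤ p + p := fun s hs => by
    refine (norm_sub_le _ _).trans (add_le_add (hp s hs) ?_)
    rw [LinearIsometryEquiv.norm_map]
    exact hp s hs
  have key := gronwall_backward (a := 0) (b := T) (f := fun s => ‖Δ s‖) (A := 0)
    (C := 2 * n * p * M * M) le_rfl (by positivity) hbd (fun g hg hg0 hfg s hs => by
      have hsub : Icc s T ⊆ Icc 0 T := Icc_subset_Icc_left hs.1
      have hi0 : 0 ≤ ∫ r in s..T, g r :=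
        intervalIntegral.integral_nonneg hs.2 fun r _ => hg0 r
      refine opNorm_le_of_norm_inner_le (by positivity) fun x y => ?_
      have bV : ∀ w, EssBounded (Icc s T) (fun r => V r s w) := hV.essBounded_left hs.2 hsub
      have i1 := ((bV y).inner (𝕜 := 𝕜) ((bQ.mono hsub).apply (bV x))).intervalIntegrable hs.2
      have i2 := (((bQ.mono hsub).apply (bV y)).inner (𝕜 := 𝕜) (bV x)).intervalIntegrable hs.2
      have h1 : ⟪P s y, x⟫ = ⟪P₀ (V T s y), V T s x⟫ + ∫ r in s..T, ⟪Q r (V r s y), V r s x⟫ := by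
        rw [← inner_conj_symm, hP s hs y x, map_add, inner_conj_symm]
        congr 1
        rw [intervalIntegral.integral_of_le hs.2, intervalIntegral.integral_of_le hs.2,
          ← integral_conj]
        simp only [inner_conj_symm]
      have h2 : ⟪y, Δ s x⟫
          = ∫ r in s..T, (⟪V r s y, Q r (V r s x)⟫ - ⟪Q r (V r s y), V r s x⟫) := by
        rw [intervalIntegral.integral_sub i1 i2, hΔin, h1, hP s hs x y, hP₀]
        abel
      rw [h2]
      refine (norm_integral_le_mul_integral (C := 2 * n * p * M * M * ‖x‖ * ‖y‖) hs.2 hg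
        (Filter.Eventually.of_forall fun r hr => ?_)).trans (by linarith)
      have hr' : r ∈ Icc 0 T := ⟨hs.1.trans hr.1.le, hr.2⟩
      have hVr := hM s r hs.1 hr.1.le hr.2
      have ha := (V r s).le_of_opNorm_le hVr y
      have hb := (V r s).le_of_opNorm_le hVr x
      set a := V r s y
      set b := V r s x
      -- The quadratic term is `P N P`, not `P* N P`, so `Q` is not symmetric a priori. Its
      -- antisymmetric part is linear in `Δ = P - P*`, because the terms `⟨P a, N P b⟩` cancel;
      -- Gronwall then forces `Δ = 0`.
      have h3 : ⟪a, Q r b⟫ - ⟪Q r a, b⟫ = ⟪a, Δ r (N r (P r b))⟫ + ⟪N r (P r a), Δ r b⟫ := by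
        rw [hΔin, hΔin, hQ r hr', hQ r hr', inner_add_right, inner_add_left, hW r hr',
          hN r hr' (P r a) (P r b)]
        abel
      rw [h3]
      refine (norm_add_le _ _).trans ?_
      have h4 : ‖⟪a, Δ r (N r (P r b))⟫‖ ≤ (M * ‖y‖) * (g r * (n * (p * (M * ‖x‖)))) :=
        (norm_inner_le_norm _ _).trans (mul_le_mul ha
          ((Δ r).le_of_opNorm_le_of_le (hfg r hr') ((N r).le_of_opNorm_le_of_le (hn r hr')
            ((P r).le_of_opNorm_le_of_le (hp r hr') hb))) (norm_nonneg _) (by positivity))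
      have h5 : ‖⟪N r (P r a), Δ r b⟫‖ ≤ (n * (p * (M * ‖y‖))) * (g r * (M * ‖x‖)) :=
        (norm_inner_le_norm _ _).trans (mul_le_mul ((N r).le_of_opNorm_le_of_le (hn r hr')
            ((P r).le_of_opNorm_le_of_le (hp r hr') ha))
          ((Δ r).le_of_opNorm_le_of_le (hfg r hr') hb) (norm_nonneg _) (by positivity))
      linarith) s hs
  have hΔ0 : Δ s = 0 := by
    apply norm_le_zero_iff.mp
    simpa using key
  intro x y
  have := hΔin s y x
  rw [hΔ0] at this
  simpa using (sub_eq_zero.mp (this.symm.trans (by simp))).symm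

variable [NormedSpace ℝ H]

/-- The Lyapunov equation tested along a mild solution of the inhomogeneous equation. -/
lemma IsLyapunovSolution.inner_mild {T M : ℝ} {V : ℝ → ℝ → H →L[𝕜] H} {P₀ : H →L[𝕜] H}
    {Q P : ℝ → H →L[𝕜] H} (hP : IsLyapunovSolution T V P₀ Q P)
    (hV : IsEvolutionOperator (Icc 0 T) V)
    (hM : ∀ s t, 0 ≤ s → s ≤ t → t ≤ T → ‖V t s‖ ≤ M)
    (bQ : StrongBounded (Icc 0 T) Q) (bP : StrongBounded (Icc 0 T) P)
    {s : ℝ} (hs : s ∈ Icc 0 T) {f z : ℝ → H} (bf : EssBounded (Icc s T) f) (x y : H)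
    (hz : ∀ r ∈ Icc s T, z r = V r s x + ∫ σ in s..r, V r σ (f σ)) :
    ⟪V T s y, P₀ (z T)⟫ + ∫ r in s..T, ⟪V r s y, Q r (z r)⟫ =
      ⟪y, P s x⟫ + ∫ r in s..T, ⟪V r s y, P r (f r)⟫ := by
  have hsT : s ≤ T := hs.2
  have hT : T ∈ Icc 0 T := ⟨hs.1.trans hsT, le_rfl⟩
  have hsub : Icc s T ⊆ Icc 0 T := Icc_subset_Icc_left hs.1
  have bVx : ∀ w, EssBounded (Icc s T) (fun r => V r s w) := hV.essBounded_left hsT hsub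
  set ξ : ℝ → H := fun r => ∫ σ in s..r, V r σ (f σ) with hξ
  have bξ : EssBounded (Icc s T) ξ :=
    (hV.mono hsub).essBounded_integral hsT (fun a b ha => hM a b (hs.1.trans ha)) bf
  have bQ' := bQ.mono hsub
  have bVf : EssBounded (Icc s T) (fun r => V T r (f r)) :=
    (hV.strongBounded_right hsT hsub).apply bf
  have i1 := ((bVx y).inner (𝕜 := 𝕜) (bQ'.apply (bVx x))).intervalIntegrable hsT
  have i2 := ((bVx y).inner (𝕜 := 𝕜) (bQ'.apply bξ)).intervalIntegrable hsT
  have i3 := ((bVx y).inner (𝕜 := 𝕜) ((bP.mono hsub).apply bf)).intervalIntegrable hsT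
  have bA : StrongBounded (Icc s T) (fun r => innerSL 𝕜 (V r s y) ∘L Q r) :=
    (bVx y).innerSL.comp bQ'
  have hsplit : ∫ r in s..T, ⟪V r s y, Q r (z r)⟫ =
      (∫ r in s..T, ⟪V r s y, Q r (V r s x)⟫) + ∫ r in s..T, ⟪V r s y, Q r (ξ r)⟫ := by
    rw [← intervalIntegral.integral_add i1 i2]
    refine intervalIntegral.integral_congr fun r hr => ?_
    rw [uIcc_of_le hsT] at hr
    simp only [hz r hr, map_add, inner_add_right, hξ]
  have hfub : ∫ r in s..T, ⟪V r s y, Q r (ξ r)⟫ =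
      ∫ r in s..T, ∫ ρ in r..T, ⟪V ρ s y, Q ρ (V ρ r (f r))⟫ :=
    (hV.mono hsub).integral_triangle_swap hsT (fun a b ha => hM a b (hs.1.trans ha)) bA bf
  have hterm : ⟪V T s y, P₀ (ξ T)⟫ = ∫ r in s..T, ⟪V T s y, P₀ (V T r (f r))⟫ :=
    (ContinuousLinearMap.intervalIntegral_comp_comm (innerSL 𝕜 (V T s y) ∘L P₀)
      (bVf.intervalIntegrable hsT)).symm
  have i4 : IntervalIntegrable (fun r => ⟪V T s y, P₀ (V T r (f r))⟫) volume s T := by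
    have bc : StrongBounded (Icc s T) (fun _ : ℝ => innerSL 𝕜 (V T s y) ∘L P₀) :=
      StrongBounded.of_continuousOn continuousOn_const
    exact (bc.apply bVf).intervalIntegrable hsT
  -- For fixed `r` the inner integral is the Lyapunov equation started at `r`, tested with `V r s y`
  -- and `f r`, by the evolution property.
  have hinner : ∫ r in s..T, ∫ ρ in r..T, ⟪V ρ s y, Q ρ (V ρ r (f r))⟫ =
      (∫ r in s..T, ⟪V r s y, P r (f r)⟫) - ∫ r in s..T, ⟪V T s y, P₀ (V T r (f r))⟫ := by
    rw [← intervalIntegral.integral_sub i3 i4]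
    refine intervalIntegral.integral_congr fun r hr => ?_
    rw [uIcc_of_le hsT] at hr
    have h1 := hP r (hsub hr) (f r) (V r s y)
    rw [hV.comp_apply hs (hsub hr) hT hr.1 hr.2] at h1
    have h2 : ∫ ρ in r..T, ⟪V ρ r (V r s y), Q ρ (V ρ r (f r))⟫ =
        ∫ ρ in r..T, ⟪V ρ s y, Q ρ (V ρ r (f r))⟫ := by
      refine intervalIntegral.integral_congr fun ρ hρ => ?_
      rw [uIcc_of_le hr.2] at hρ
      simp only [hV.comp_apply hs (hsub hr) (hsub ⟨hr.1.trans hρ.1, hρ.2⟩) hr.1 hρ.1]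
    rw [h2] at h1
    simp only [h1]
    abel
  rw [hsplit, hfub, hinner, hz T ⟨hsT, le_rfl⟩, map_add, inner_add_right, hterm, hP s hs x y]
  abel

/-- The solution of the Riccati equation is a lower bound for the quadratic cost of every mild
solution of the control system. -/
lemma IsLyapunovSolution.le_cost {T M : ℝ} {V : ℝ → ℝ → H →L[𝕜] H} {P₀ : H →L[𝕜] H}
    {Q P W : ℝ → H →L[𝕜] H} {B : ℝ → X →L[𝕜] H} {K : ℝ → H →L[𝕜] X} {R : ℝ → X →L[𝕜] X}
    (hP : IsLyapunovSolution T V P₀ Q P)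
    (hV : IsEvolutionOperator (Icc 0 T) V)
    (hM : ∀ s t, 0 ≤ s → s ≤ t → t ≤ T → ‖V t s‖ ≤ M)
    (bQ : StrongBounded (Icc 0 T) Q) (bP : StrongBounded (Icc 0 T) P)
    (bW : StrongBounded (Icc 0 T) W) (bB : StrongBounded (Icc 0 T) B)
    (bK : StrongBounded (Icc 0 T) K) (bR : StrongBounded (Icc 0 T) R)
    (hP₀ : P₀.IsPositive) (hW : ∀ r ∈ Icc 0 T, (W r).IsPositive)
    (hR : ∀ r ∈ Icc 0 T, (R r).IsPositive)
    (hQ : ∀ r ∈ Icc 0 T, ∀ x y, ⟪y, Q r x⟫ = ⟪y, W r x⟫ + ⟪K r y, R r (K r x)⟫)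
    (hPB : ∀ r ∈ Icc 0 T, ∀ x u, ⟪x, P r (B r u)⟫ = ⟪K r x, R r u⟫)
    {s : ℝ} (hs : s ∈ Icc 0 T) (x : H) {z : ℝ → H} {u : ℝ → X}
    (bz : EssBounded (Icc s T) z) (bu : EssBounded (Icc s T) u)
    (hz : ∀ r ∈ Icc s T, z r = V r s x + ∫ σ in s..r, V r σ (B σ (u σ + K σ (z σ)))) :
    RCLike.re ⟪x, P s x⟫ ≤ RCLike.re ⟪z T, P₀ (z T)⟫ +
      ∫ r in s..T, (RCLike.re ⟪z r, W r (z r)⟫ + RCLike.re ⟪u r, R r (u r)⟫) := by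
  have hsub : Icc s T ⊆ Icc 0 T := Icc_subset_Icc_left hs.1
  have bV : EssBounded (Icc s T) (fun r => V r s x) := hV.essBounded_left hs.2 hsub x
  have bW' := bW.mono hsub
  have bK' := bK.mono hsub
  have bR' := bR.mono hsub
  have bf : EssBounded (Icc s T) (fun r => B r (u r + K r (z r))) :=
    (bB.mono hsub).apply (bu.add (bK'.apply bz))
  have h1 := hP.inner_mild hV hM bQ bP hs bf x x hz
  have iQ := (bV.inner (𝕜 := 𝕜) ((bQ.mono hsub).apply bz)).intervalIntegrable hs.2
  have iP := (bV.inner (𝕜 := 𝕜) ((bP.mono hsub).apply bf)).intervalIntegrable hs.2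
  -- The terms in `K z` cancel between `Q` and `P B`, leaving the bilinear cost of the pairs `(V x,
  -- -K V x)` and `(z, u)`. Twice this is at most the sum of the two costs, and the first cost is
  -- `⟨x, P x⟩` itself, so one copy can be subtracted.
  have h2 : RCLike.re ⟪x, P s x⟫ = RCLike.re ⟪V T s x, P₀ (z T)⟫ +
      ∫ r in s..T, (RCLike.re ⟪V r s x, W r (z r)⟫ - RCLike.re ⟪K r (V r s x), R r (u r)⟫) := by
    have h3 : ⟪x, P s x⟫ = ⟪V T s x, P₀ (z T)⟫ +
        ((∫ r in s..T, ⟪V r s x, Q r (z r)⟫) -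
          ∫ r in s..T, ⟪V r s x, P r (B r (u r + K r (z r)))⟫) := by
      rw [← add_sub_assoc, h1]; abel
    rw [h3, map_add, ← intervalIntegral.integral_sub iQ iP, ← intervalIntegral_re (iQ.sub iP)]
    congr 1
    refine intervalIntegral.integral_congr fun r hr => ?_
    rw [uIcc_of_le hs.2] at hr
    simp only [hQ r (hsub hr), hPB r (hsub hr), map_add, map_sub, inner_add_right]
    ring
  have h4 := hP.cost_eq hV bQ hQ hs x
  have reI : ∀ {f : ℝ → 𝕜}, EssBounded (Icc s T) f →
      IntervalIntegrable (fun r => RCLike.re (f r)) volume s T := fun hf =>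
    ⟨(hf.intervalIntegrable hs.2).1.re, (hf.intervalIntegrable hs.2).2.re⟩
  have j1 := (reI (bV.inner (𝕜 := 𝕜) (bW'.apply bz))).sub
    (reI ((bK'.apply bV).inner (𝕜 := 𝕜) (bR'.apply bu)))
  have j2 := (reI (bV.inner (𝕜 := 𝕜) (bW'.apply bV))).add
    (reI ((bK'.apply bV).inner (𝕜 := 𝕜) (bR'.apply (bK'.apply bV))))
  have j3 := (reI (bz.inner (𝕜 := 𝕜) (bW'.apply bz))).add
    (reI (bu.inner (𝕜 := 𝕜) (bR'.apply bu)))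
  have h5 : 2 * ∫ r in s..T,
      (RCLike.re ⟪V r s x, W r (z r)⟫ - RCLike.re ⟪K r (V r s x), R r (u r)⟫) ≤
      (∫ r in s..T, (RCLike.re ⟪V r s x, W r (V r s x)⟫ +
        RCLike.re ⟪K r (V r s x), R r (K r (V r s x))⟫)) +
      ∫ r in s..T, (RCLike.re ⟪z r, W r (z r)⟫ + RCLike.re ⟪u r, R r (u r)⟫) := by
    rw [← intervalIntegral.integral_const_mul, ← intervalIntegral.integral_add j2 j3]
    refine intervalIntegral.integral_mono_on hs.2 (j1.const_mul _) (j2.add j3) fun r hr => ?_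
    have h6 := (hW r (hsub hr)).two_mul_re_inner_le (V r s x) (z r)
    have h7 := (hR r (hsub hr)).two_mul_re_inner_le (-(K r (V r s x))) (u r)
    simp only [map_neg, inner_neg_neg] at h7
    rw [inner_neg_left, map_neg] at h7
    linarith
  have h8 := hP₀.two_mul_re_inner_le (V T s x) (z T)
  linarith

end Lyapunov

/-! ### From the Riccati equation to the value function -/

section Riccati

variable {𝕜 : Type*} [RCLike 𝕜]
  {H : Type*} [NormedAddCommGroup H] [InnerProductSpace 𝕜 H]
  {X : Type*} [NormedAddCommGroup X] [InnerProductSpace 𝕜 X]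

local notation "⟪" x ", " y "⟫" => inner 𝕜 x y

lemma IsBoundedContinuous.strongBounded {G : ℝ → H →L[𝕜] X} (hG : IsBoundedContinuous G) (T : ℝ) :
    StrongBounded (Icc 0 T) G :=
  StrongBounded.of_continuousOn (hG.1.mono Icc_subset_Ici_self)

lemma IsBoundedContinuous.exists_bound {G : ℝ → H →L[𝕜] X} (hG : IsBoundedContinuous G) :
    ∃ C, 0 ≤ C ∧ ∀ t, 0 ≤ t → ‖G t‖ ≤ C := by
  obtain ⟨C, hC⟩ := hG.2
  exact ⟨C, (norm_nonneg _).trans (hC 0 le_rfl), hC⟩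

lemma IsStronglyMeasurableEssBounded.strongBounded {T : ℝ} {G : ℝ → H →L[𝕜] X}
    (hG : IsStronglyMeasurableEssBounded T G) : StrongBounded (Icc 0 T) G := by
  obtain ⟨C, hC⟩ := hG.2
  exact ⟨hG.1, max C 0, le_max_right _ _, hC.mono fun t ht => ht.trans (le_max_left _ _)⟩

lemma continuousOn_inverse_of_coercive [CompleteSpace X] {s : Set ℝ} {N : ℝ → X →L[𝕜] X} {δ : ℝ}
    (hδ : 0 < δ) (hN : ContinuousOn N s) (h : ∀ t ∈ s, ∀ u, δ * ‖u‖ ^ 2 ≤ RCLike.re ⟪u, N t u⟫) :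
    ContinuousOn (fun t => (N t).inverse) s := by
  rw [← ContinuousLinearMap.ringInverse_eq_inverse]
  intro t ht
  obtain ⟨v, hv⟩ := isUnit_of_coercive hδ (h t ht)
  have h1 := NormedRing.inverse_continuousAt v
  rw [hv] at h1
  exact h1.comp_continuousWithinAt (hN t ht)

variable [NormedSpace ℝ H] [CompleteSpace H] [CompleteSpace X]

lemma IsRiccatiSolution.isLyapunovSolution {Y : ℝ → ℝ → H →L[𝕜] H} {B : ℝ → X →L[𝕜] H}
    {P₀ : H →L[𝕜] H} {W : ℝ → H →L[𝕜] H} {R : ℝ → X →L[𝕜] X} {T : ℝ}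
    {P : ℝ → H →L[𝕜] H} {V : ℝ → ℝ → H →L[𝕜] H} (h : IsRiccatiSolution Y B P₀ W R T P V) :
    IsLyapunovSolution T V P₀ (fun r => W r + P r ∘L B r ∘L riccatiFeedback B R P r) P := by
  intro s hs x y
  have e := ContinuousLinearMap.intervalIntegral_comp_comm (innerSL 𝕜 y) (h.integrable s hs x)
  simp only [innerSL_apply_apply, ContinuousLinearMap.adjoint_inner_right] at e
  rw [h.eq s hs x, inner_add_right, ContinuousLinearMap.adjoint_inner_right, ← e]

/-- The cost functional controlled by a Riccati solution: symmetry of the solution, its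
representation by the closed-loop cost, and its minimality among bounded feedbacks. -/
lemma IsRiccatiSolution.cost {Y : ℝ → ℝ → H →L[𝕜] H} {B : ℝ → X →L[𝕜] H}
    {P₀ : H →L[𝕜] H} {W : ℝ → H →L[𝕜] H} {R : ℝ → X →L[𝕜] X} {T M δ₀ : ℝ}
    {P : ℝ → H →L[𝕜] H} {V : ℝ → ℝ → H →L[𝕜] H} (h : IsRiccatiSolution Y B P₀ W R T P V)
    (hY : IsEvolutionOperator (Icc 0 T) Y)
    (hMY : ∀ s t, 0 ≤ s → s ≤ t → t ≤ T → ‖Y t s‖ ≤ M)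
    (hMV : ∀ s t, 0 ≤ s → s ≤ t → t ≤ T → ‖V t s‖ ≤ M)
    (hB : IsBoundedContinuous B) (hW : IsBoundedContinuous W) (hR : IsBoundedContinuous R)
    (hP₀ : P₀.IsPositive) (hW_pos : ∀ t, 0 ≤ t → (W t).IsPositive)
    (hR_sa : ∀ t, 0 ≤ t → IsSelfAdjoint (R t)) (hδ₀ : 0 < δ₀)
    (hR_coercive : ∀ t, 0 ≤ t → ∀ u, δ₀ * ‖u‖ ^ 2 ≤ RCLike.re ⟪u, R t u⟫)
    (bK : StrongBounded (Icc 0 T) (riccatiFeedback B R P)) {s : ℝ} (hs : s ∈ Icc 0 T) :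
    (∀ x y, ⟪P s x, y⟫ = ⟪x, P s y⟫) ∧
    (∀ x, RCLike.re ⟪x, P s x⟫ = RCLike.re ⟪V T s x, P₀ (V T s x)⟫ +
      ∫ r in s..T, (RCLike.re ⟪V r s x, W r (V r s x)⟫ +
        RCLike.re ⟪riccatiFeedback B R P r (V r s x),
          R r (riccatiFeedback B R P r (V r s x))⟫)) ∧
    ∀ (F : ℝ → H →L[𝕜] X) (Z : ℝ → ℝ → H →L[𝕜] H), StrongBounded (Icc 0 T) F →
      IsPerturbedEvolutionOperator (Icc 0 T) Y (fun t => B t ∘L F t) Z →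
      ∀ x, RCLike.re ⟪x, P s x⟫ ≤ RCLike.re ⟪Z T s x, P₀ (Z T s x)⟫ +
        ∫ r in s..T, (RCLike.re ⟪Z r s x, W r (Z r s x)⟫ +
          RCLike.re ⟪F r (Z r s x), R r (F r (Z r s x))⟫) := by
  have hV := h.closedLoop.evolution
  set K := riccatiFeedback B R P with hK
  have hL := h.isLyapunovSolution
  have bP := h.bounded.strongBounded
  have bB := hB.strongBounded T
  have bW := hW.strongBounded T
  have bR := hR.strongBounded T
  have bQ : StrongBounded (Icc 0 T) (fun r => W r + P r ∘L B r ∘L K r) :=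
    bW.add (bP.comp (bB.comp bK))
  have hR_pos : ∀ r ∈ Icc 0 T, (R r).IsPositive := fun r hr =>
    ⟨(hR_sa r hr.1).isSymmetric, fun u => by
      rw [ContinuousLinearMap.reApplyInnerSelf_apply, inner_re_symm]
      exact le_trans (by positivity) (hR_coercive r hr.1 u)⟩
  have hRinv : ∀ r ∈ Icc 0 T, ∀ u, R r ((R r).inverse u) = u := fun r hr =>
    apply_inverse_of_coercive hδ₀ (hR_coercive r hr.1)
  obtain ⟨cB, hcB0, hcB⟩ := hB.exists_bound
  have hsym := hL.symmetric (n := cB * (1 / δ₀ * cB)) (W := W)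
    (N := fun r => B r ∘L (R r).inverse ∘L (B r).adjoint) hV hMV bQ
    (fun r _ x => rfl) hP₀.1 (fun r hr => (hW_pos r hr.1).1)
    (fun r hr x y => by
      simp only [ContinuousLinearMap.comp_apply]
      rw [← ContinuousLinearMap.adjoint_inner_right (B r) _ y,
        ← ContinuousLinearMap.adjoint_inner_left (B r) _ x]
      conv_lhs => rw [← hRinv r hr ((B r).adjoint y)]
      conv_rhs => rw [← hRinv r hr ((B r).adjoint x)]
      exact ((hR_pos r hr).1 _ _).symm)
    (fun r hr => by
      refine (ContinuousLinearMap.opNorm_comp_le _ _).trans (mul_le_mul (hcB r hr.1)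
        ((ContinuousLinearMap.opNorm_comp_le _ _).trans (mul_le_mul
          (norm_inverse_le_of_coercive hδ₀ (hR_coercive r hr.1)) ?_ (norm_nonneg _)
          (by positivity))) (norm_nonneg _) hcB0)
      rw [LinearIsometryEquiv.norm_map]
      exact hcB r hr.1)
  -- Symmetry of `P` turns `P B` into `K* R`, so that `P B K = K* R K` is the control cost of the
  -- closed loop.
  have hPB : ∀ r ∈ Icc 0 T, ∀ x u, ⟪x, P r (B r u)⟫ = ⟪K r x, R r u⟫ := by
    intro r hr x u
    have e : ⟪K r x, R r u⟫ = ⟪R r (K r x), u⟫ := ((hR_pos r hr).1 _ _).symm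
    rw [e, ← hsym r hr, ← ContinuousLinearMap.adjoint_inner_left]
    congr 1
    exact (hRinv r hr _).symm
  have hQ : ∀ r ∈ Icc 0 T, ∀ x y, ⟪y, (W r + P r ∘L B r ∘L K r) x⟫
      = ⟪y, W r x⟫ + ⟪K r y, R r (K r x)⟫ := by
    intro r hr x y
    rw [← hPB r hr]
    simp [inner_add_right]
  refine ⟨hsym s hs, hL.cost_eq hV bQ hQ hs, fun F Z bF hZ x => ?_⟩
  have hsub : Icc s T ⊆ Icc 0 T := Icc_subset_Icc_left hs.1
  have bz : EssBounded (Icc s T) (fun r => Z r s x) := hZ.evolution.essBounded_left hs.2 hsub x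
  refine hL.le_cost hV hMV bQ bP bW bB bK bR hP₀ (fun r hr => hW_pos r hr.1) hR_pos hQ hPB hs x
    bz ((bF.mono hsub).apply bz) fun r hr => ?_
  -- The competing trajectory is a mild solution around the optimal closed loop: the generators
  -- differ by `B F + B K`, which is the forcing `B (u + K z)` with `u = F z`.
  have e := h.closedLoop.eq_add_integral hY hZ hMY hMV (bB.comp bK).neg (bB.comp bF) hs.1 hr.1
    hr.2 x
  rw [e]
  congr 1
  refine intervalIntegral.integral_congr fun σ _ => ?_
  simp [map_add, hK]

end Riccati

/-! ### Convolution estimate and the main theorem -/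

section UniformBounds

/-- A weighted arithmetic-geometric mean bound for the convolution of an exponential with square
integrable functions. -/
lemma integral_exp_mul_le {α M cB cL δ δ₀ n s t : ℝ} (hα : 0 < α) (hM : 0 ≤ M) (hcB : 0 ≤ cB)
    (hcL : 0 ≤ cL) (hδ₀ : 0 < δ₀) (hn : 0 < n) (hst : s ≤ t) {k w : ℝ → ℝ}
    (hk : IntervalIntegrable (fun r => k r ^ 2) volume s t)
    (hw : IntervalIntegrable (fun r => w r ^ 2) volume s t)
    (h : ∫ r in s..t, (w r ^ 2 + δ₀ * k r ^ 2) ≤ δ * n ^ 2)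
    {E : Type*} [NormedAddCommGroup E] [NormedSpace ℝ E] {f : ℝ → E}
    (hf : ∀ r ∈ Ioc s t, ‖f r‖ ≤ M * Real.exp (-α * (t - r)) * (cB * k r + cL * w r)) :
    ‖∫ r in s..t, f r‖ ≤ M * ((cB + cL) / (2 * α) + (cB / δ₀ + cL) * δ) * n := by
  have hexp : IntervalIntegrable (fun r => n * (cB + cL) * Real.exp (-(2 * α) * (t - r)))
      volume s t := Continuous.intervalIntegrable (by fun_prop) _ _
  have hkw := hw.add (hk.const_mul δ₀)
  have h1 := intervalIntegral.norm_integral_le_of_norm_le (μ := volume) (f := f)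
    (g := fun r => M * (n * (cB + cL) * Real.exp (-(2 * α) * (t - r)) +
      (cB / δ₀ + cL) / n * (w r ^ 2 + δ₀ * k r ^ 2))) hst
    (Filter.Eventually.of_forall fun r hr => by
      refine (hf r hr).trans ?_
      rw [mul_assoc]
      refine mul_le_mul_of_nonneg_left ?_ hM
      set e := Real.exp (-α * (t - r)) with he
      have he2 : Real.exp (-(2 * α) * (t - r)) = e ^ 2 := by
        rw [he, ← Real.exp_nat_mul]; congr 1; push_cast; ring
      rw [he2]
      -- The weight `n`, later `‖x‖`, makes both parts linear in `n` after integration, since the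
      -- squares integrate to at most a multiple of `n²`.
      have amgm : ∀ a, e * a ≤ n * e ^ 2 + a ^ 2 / n := fun a => by
        have h3 : n * e ^ 2 + a ^ 2 / n = ((n * e) ^ 2 + a ^ 2) / n := by field_simp
        rw [h3, le_div_iff₀ hn]
        nlinarith [sq_nonneg (n * e - a), sq_nonneg (n * e), sq_nonneg a]
      have h4 := mul_le_mul_of_nonneg_left (amgm (k r)) hcB
      have h5 := mul_le_mul_of_nonneg_left (amgm (w r)) hcL
      have h6 : (cB / δ₀ + cL) / n * (w r ^ 2 + δ₀ * k r ^ 2)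
          = cB * (k r ^ 2 / n) + cL * (w r ^ 2 / n) + cB / δ₀ * (w r ^ 2 / n)
            + cL * δ₀ * (k r ^ 2 / n) := by
        field_simp; ring
      have h7 : 0 ≤ cB / δ₀ * (w r ^ 2 / n) := by positivity
      have h8 : 0 ≤ cL * δ₀ * (k r ^ 2 / n) := by positivity
      linarith)
    ((hexp.add (hkw.const_mul _)).const_mul _)
  rw [intervalIntegral.integral_const_mul, intervalIntegral.integral_add hexp (hkw.const_mul _),
    intervalIntegral.integral_const_mul, intervalIntegral.integral_const_mul] at h1
  refine h1.trans ?_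
  rw [mul_assoc M _ n]
  refine mul_le_mul_of_nonneg_left ?_ hM
  have h2 := mul_le_mul_of_nonneg_left
    (integral_exp_neg_mul_sub_le (β := 2 * α) (by positivity) s t)
    (by positivity : 0 ≤ n * (cB + cL))
  have h3 := mul_le_mul_of_nonneg_left h (by positivity : 0 ≤ (cB / δ₀ + cL) / n)
  have h4 : (cB / δ₀ + cL) / n * (δ * n ^ 2) = (cB / δ₀ + cL) * δ * n := by field_simp
  have h5 : n * (cB + cL) * (1 / (2 * α)) = (cB + cL) / (2 * α) * n := by field_simp
  linarith

end UniformBounds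

theorem mainTheorem6 {𝕜 : Type*} [RCLike 𝕜]
    {H : Type*} [NormedAddCommGroup H] [InnerProductSpace 𝕜 H] [NormedSpace ℝ H] [CompleteSpace H]
    {X : Type*} [NormedAddCommGroup X] [InnerProductSpace 𝕜 X] [CompleteSpace X]
    (Y : ℝ → ℝ → H →L[𝕜] H) (B : ℝ → X →L[𝕜] H)
    (P₀ : H →L[𝕜] H) (W W_sqrt : ℝ → H →L[𝕜] H) (R : ℝ → X →L[𝕜] X)
    (hY : IsEvolutionOperator (Ici 0) Y)
    (hB : IsBoundedContinuous B)
    (hP₀ : P₀.IsPositive)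
    (hW : IsBoundedContinuous W) (hW_pos : ∀ t : ℝ, 0 ≤ t → (W t).IsPositive)
    (hR : IsBoundedContinuous R) (hR_sa : ∀ t : ℝ, 0 ≤ t → IsSelfAdjoint (R t))
    (hR_coercive : ∃ δ₀ > (0 : ℝ), ∀ t : ℝ, 0 ≤ t → ∀ u : X,
      δ₀ * ‖u‖ ^ 2 ≤ RCLike.re (inner 𝕜 u (R t u)))
    (hW_sqrt : IsPositiveSqrt W_sqrt W)
    (hstab : IsUniformlyStabilizable Y B)
    (hdet : IsUniformlyDetectable Y W_sqrt) :
    ∃ δ_P δ_Y : ℝ, ∀ T > (0 : ℝ), ∀ (P : ℝ → H →L[𝕜] H) (V : ℝ → ℝ → H →L[𝕜] H),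
      IsRiccatiSolution Y B P₀ W R T P V →
        ‖P 0‖ ≤ δ_P ∧ ∀ s t : ℝ, 0 ≤ s → s ≤ t → t ≤ T → ‖V t s‖ ≤ δ_Y := by
  obtain ⟨δ₀, hδ₀, hRc⟩ := hR_coercive
  obtain ⟨F, hF, Z, hZ, MZ, hMZ0, α, hα, hZexp⟩ := hstab
  obtain ⟨L, hL, YL, hYL, ML, hML0, β, hβ, hYLexp⟩ := hdet
  obtain ⟨cB, hcB0, hcB⟩ := hB.exists_bound
  obtain ⟨cW, hcW0, hcW⟩ := hW.exists_bound
  obtain ⟨cR, hcR0, hcR⟩ := hR.exists_bound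
  obtain ⟨cF, hcF0, hcF⟩ := hF.exists_bound
  obtain ⟨cL, hcL0, hcL⟩ := hL.exists_bound
  have hS : ContinuousOn W_sqrt (Ici 0) := continuousOn_sqrt hW_sqrt hW.1
  have exp_le_one : ∀ {γ s t : ℝ}, 0 < γ → s ≤ t → Real.exp (-γ * (t - s)) ≤ 1 := by
    intro γ s t hγ hst
    rw [Real.exp_le_one_iff]
    nlinarith
  have hZM : ∀ s t, 0 ≤ s → s ≤ t → ‖Z t s‖ ≤ MZ := fun s t hs hst =>
    (hZexp s t hs hst).trans (mul_le_of_le_one_right hMZ0 (exp_le_one hα hst))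
  have hYLM : ∀ s t, 0 ≤ s → s ≤ t → ‖YL t s‖ ≤ ML := fun s t hs hst =>
    (hYLexp s t hs hst).trans (mul_le_of_le_one_right hML0 (exp_le_one hβ hst))
  -- Along the stabilized trajectory the running cost at time `r` is at most `q exp (-2α(r - s))
  -- ‖x‖²`; integrating and adding the terminal cost gives `δ`.
  set q : ℝ := (cW + cR * cF ^ 2) * MZ ^ 2 with hq
  set δ : ℝ := ‖P₀‖ * MZ ^ 2 + q / (2 * α) with hδ
  have hq0 : 0 ≤ q := by positivity
  have hδ0 : 0 ≤ δ := by positivity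
  refine ⟨δ, ML * (1 + ((cB + cL) / (2 * β) + (cB / δ₀ + cL) * δ)), fun T hT P V h => ?_⟩
  have hI : Icc 0 T ⊆ Ici (0 : ℝ) := Icc_subset_Ici_self
  have hYT := hY.mono hI
  have hZT := hZ.mono hI
  have hYLT := hYL.mono hI
  have bB := hB.strongBounded T
  have bF := hF.strongBounded T
  have bW := hW.strongBounded T
  have bR := hR.strongBounded T
  have bS : StrongBounded (Icc 0 T) W_sqrt := StrongBounded.of_continuousOn (hS.mono hI)
  have bK : StrongBounded (Icc 0 T) (riccatiFeedback B R P) :=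
    (StrongBounded.of_continuousOn
      (continuousOn_inverse_of_coercive hδ₀ (hR.1.mono hI) fun t ht => hRc t ht.1)).comp
      ((StrongBounded.of_continuousOn (ContinuousLinearMap.adjoint.continuous.comp_continuousOn
        (hB.1.mono hI))).comp h.bounded.strongBounded)
  -- The bounds `MY` and `MV` may depend on `T` and on the solution. They serve only to justify the
  -- integral identities and do not enter the final constants.
  obtain ⟨MY, hMY⟩ : ∃ M', ∀ s t, 0 ≤ s → s ≤ t → t ≤ T → ‖Y t s‖ ≤ M' := by
    obtain ⟨c, hc0, hc⟩ := (bB.comp bF).bdd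
    exact hZT.exists_bound_unperturbed hT.le hYT hc0 hc fun s t hs hst _ => hZM s t hs hst
  obtain ⟨MV, hMV⟩ : ∃ M', ∀ s t, 0 ≤ s → s ≤ t → t ≤ T → ‖V t s‖ ≤ M' := by
    obtain ⟨c, hc0, hc⟩ := (bB.comp bK).neg.bdd
    exact h.closedLoop.exists_bound hT.le hc0 hc hMY
  have cost := fun s (hs : s ∈ Icc 0 T) => h.cost (M := max MY MV) hYT
    (fun s t h1 h2 h3 => (hMY s t h1 h2 h3).trans (le_max_left _ _))
    (fun s t h1 h2 h3 => (hMV s t h1 h2 h3).trans (le_max_right _ _))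
    hB hW hR hP₀ hW_pos hR_sa hδ₀ hRc bK hs
  set K := riccatiFeedback B R P with hK
  have hle : ∀ s ∈ Icc 0 T, ∀ x, RCLike.re (inner 𝕜 x (P s x)) ≤ δ * ‖x‖ ^ 2 := by
    intro s hs x
    refine ((cost s hs).2.2 F Z bF hZT x).trans ?_
    have hnT := (Z T s).le_of_opNorm_le (hZM s T hs.1 hs.2) x
    have h1 : RCLike.re (inner 𝕜 (Z T s x) (P₀ (Z T s x))) ≤ ‖P₀‖ * (MZ * ‖x‖) ^ 2 :=
      (re_inner_apply_self_le _ _).trans (by gcongr)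
    have h2 : ‖∫ r in s..T, (RCLike.re (inner 𝕜 (Z r s x) (W r (Z r s x))) +
        RCLike.re (inner 𝕜 (F r (Z r s x)) (R r (F r (Z r s x)))))‖ ≤
        q * ‖x‖ ^ 2 * ∫ r in s..T, Real.exp (-(2 * α) * (r - s)) := by
      refine norm_integral_le_mul_integral hs.2 (by fun_prop)
        (Filter.Eventually.of_forall fun r hr => ?_)
      have hr0 : 0 ≤ r := hs.1.trans hr.1.le
      set e := Real.exp (-α * (r - s)) with he
      have he2 : Real.exp (-(2 * α) * (r - s)) = e ^ 2 := by
        rw [he, ← Real.exp_nat_mul]; congr 1; push_cast; ring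
      have hz : ‖Z r s x‖ ≤ MZ * e * ‖x‖ :=
        (Z r s).le_of_opNorm_le (hZexp s r hs.1 hr.1.le) x
      set z := Z r s x
      have hFz : ‖F r z‖ ≤ cF * (MZ * e * ‖x‖) := (F r).le_of_opNorm_le_of_le (hcF r hr0) hz
      have hWz : RCLike.re (inner 𝕜 z (W r z)) ≤ cW * (MZ * e * ‖x‖) ^ 2 :=
        (re_inner_apply_self_le _ _).trans (by gcongr; exact hcW r hr0)
      have hRz : RCLike.re (inner 𝕜 (F r z) (R r (F r z))) ≤ cR * (cF * (MZ * e * ‖x‖)) ^ 2 :=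
        (re_inner_apply_self_le _ _).trans (by gcongr; exact hcR r hr0)
      have hW0 : 0 ≤ RCLike.re (inner 𝕜 z (W r z)) := (hW_pos r hr0).re_inner_nonneg_right z
      have hR0 : 0 ≤ RCLike.re (inner 𝕜 (F r z) (R r (F r z))) :=
        le_trans (by positivity) (hRc r hr0 (F r z))
      rw [Real.norm_of_nonneg (add_nonneg hW0 hR0), he2]
      have e1 : q * ‖x‖ ^ 2 * e ^ 2
          = cW * (MZ * e * ‖x‖) ^ 2 + cR * (cF * (MZ * e * ‖x‖)) ^ 2 := by rw [hq]; ring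
      linarith
    have h3 := mul_le_mul_of_nonneg_left
      (integral_exp_neg_mul_sub_le' (β := 2 * α) (by positivity) s T)
      (by positivity : 0 ≤ q * ‖x‖ ^ 2)
    have h4 := ((Real.le_norm_self _).trans h2).trans h3
    have e2 : δ * ‖x‖ ^ 2 = ‖P₀‖ * (MZ * ‖x‖) ^ 2 + q * ‖x‖ ^ 2 * (1 / (2 * α)) := by
      rw [hδ]; ring
    linarith
  have hWS : ∀ r, 0 ≤ r → ∀ v, RCLike.re (inner 𝕜 v (W r v)) = ‖W_sqrt r v‖ ^ 2 := by
    intro r hr v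
    rw [← (hW_sqrt r hr).2, ContinuousLinearMap.comp_apply, ← inner_self_eq_norm_sq (𝕜 := 𝕜)]
    exact congrArg _ ((hW_sqrt r hr).1.1 v _).symm
  have hint : ∀ s ∈ Icc 0 T, ∀ t ∈ Icc s T, ∀ x,
      IntervalIntegrable (fun r => ‖K r (V r s x)‖ ^ 2) volume s t ∧
      IntervalIntegrable (fun r => ‖W_sqrt r (V r s x)‖ ^ 2) volume s t ∧
      ∫ r in s..t, (‖W_sqrt r (V r s x)‖ ^ 2 + δ₀ * ‖K r (V r s x)‖ ^ 2) ≤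
        RCLike.re (inner 𝕜 x (P s x)) := by
    intro s hs t ht x
    have hsub : Icc s T ⊆ Icc 0 T := Icc_subset_Icc_left hs.1
    have bV : EssBounded (Icc s T) (fun r => V r s x) :=
      h.closedLoop.evolution.essBounded_left hs.2 hsub x
    have reI : ∀ {f : ℝ → 𝕜}, EssBounded (Icc s T) f →
        IntervalIntegrable (fun r => RCLike.re (f r)) volume s T := fun hf =>
      ⟨(hf.intervalIntegrable hs.2).1.re, (hf.intervalIntegrable hs.2).2.re⟩
    have bKV := (bK.mono hsub).apply bV
    have bSV := (bS.mono hsub).apply bV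
    have iK : IntervalIntegrable (fun r => ‖K r (V r s x)‖ ^ 2) volume s T := by
      simpa only [inner_self_eq_norm_sq] using reI (bKV.inner (𝕜 := 𝕜) bKV)
    have iS : IntervalIntegrable (fun r => ‖W_sqrt r (V r s x)‖ ^ 2) volume s T := by
      simpa only [inner_self_eq_norm_sq] using reI (bSV.inner (𝕜 := 𝕜) bSV)
    have iW := (reI (bV.inner (𝕜 := 𝕜) ((bW.mono hsub).apply bV))).add
      (reI (bKV.inner (𝕜 := 𝕜) ((bR.mono hsub).apply bKV)))
    have hss : uIcc s t ⊆ uIcc s T := by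
      rw [uIcc_of_le ht.1, uIcc_of_le hs.2]; exact Icc_subset_Icc_right ht.2
    refine ⟨iK.mono_set hss, iS.mono_set hss, ?_⟩
    have iSK := iS.add (iK.const_mul δ₀)
    have h1 : ∫ r in s..t, (‖W_sqrt r (V r s x)‖ ^ 2 + δ₀ * ‖K r (V r s x)‖ ^ 2) ≤
        ∫ r in s..T, (‖W_sqrt r (V r s x)‖ ^ 2 + δ₀ * ‖K r (V r s x)‖ ^ 2) :=
      intervalIntegral.integral_mono_interval le_rfl ht.1 ht.2
        (Filter.Eventually.of_forall fun r => by positivity) iSK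
    have h2 : ∫ r in s..T, (‖W_sqrt r (V r s x)‖ ^ 2 + δ₀ * ‖K r (V r s x)‖ ^ 2) ≤
        ∫ r in s..T, (RCLike.re (inner 𝕜 (V r s x) (W r (V r s x))) +
          RCLike.re (inner 𝕜 (K r (V r s x)) (R r (K r (V r s x))))) := by
      refine intervalIntegral.integral_mono_on hs.2 iSK iW fun r hr => ?_
      rw [hWS r (hs.1.trans hr.1)]
      exact add_le_add le_rfl (hRc r (hs.1.trans hr.1) _)
    have h3 := (cost s hs).2.1 x
    have h4 := hP₀.re_inner_nonneg_right (V T s x)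
    linarith
  constructor
  · have h0 : (0 : ℝ) ∈ Icc 0 T := ⟨le_rfl, hT.le⟩
    refine opNorm_le_of_abs_re_inner_le (cost 0 h0).1 hδ0 fun x => ?_
    -- On the degenerate interval the cost estimate says that the form of `P 0` is nonnegative.
    have h1 := (hint 0 h0 0 h0 x).2.2
    rw [intervalIntegral.integral_same] at h1
    rw [abs_of_nonneg h1]
    exact hle 0 h0 x
  · intro s t hs hst htT
    have hs' : s ∈ Icc 0 T := ⟨hs, hst.trans htT⟩
    refine ContinuousLinearMap.opNorm_le_bound _ (by positivity) fun x => ?_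
    rcases (norm_nonneg x).eq_or_lt with hx | hx
    · have : x = 0 := norm_eq_zero.mp hx.symm
      simp [this]
    -- Detectability enters here: `V` is written around the stable `YL`, and the difference of
    -- perturbations contains only `K V x` and `W^{1/2} V x`, both controlled in the square mean by
    -- the cost.
    have hrep := hYLT.eq_add_integral (M := max MY ML) hYT h.closedLoop
      (fun s t h1 h2 h3 => (hMY s t h1 h2 h3).trans (le_max_left _ _))
      (fun s t h1 h2 _ => (hYLM s t h1 h2).trans (le_max_right _ _))
      ((hL.strongBounded T).comp bS) (bB.comp bK).neg hs hst htT x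
    obtain ⟨iK, iS, hKS⟩ := hint s hs' t ⟨hst, htT⟩ x
    rw [hrep]
    refine (norm_add_le _ _).trans ?_
    have h1 := (YL t s).le_of_opNorm_le (hYLM s t hs hst) x
    have h2 := integral_exp_mul_le hβ hML0 hcB0 hcL0 hδ₀ hx hst iK iS
      (hKS.trans (hle s hs' x))
      (f := fun r => YL t r ((-(B r ∘L K r) - L r ∘L W_sqrt r) (V r s x))) (fun r hr => by
        have hr0 : 0 ≤ r := hs.trans hr.1.le
        refine (YL t r).le_of_opNorm_le_of_le (hYLexp r t hr0 hr.2) ?_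
        refine (norm_sub_le _ _).trans (add_le_add ?_ ?_)
        · exact (norm_neg _).trans_le ((B r).le_of_opNorm_le (hcB r hr0) (K r (V r s x)))
        · exact (L r).le_of_opNorm_le (hcL r hr0) _)
    linarith
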